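/- Let $n\ge 2$ and write $B_r=\{x\in\mathbb R^n:|x|<r\}$. Let $\Omega\subset\mathbb R^n$ be a bounded domain with $0\in\partial\Omega$ satisfying condition (H1) at $0$ with constants $0<\tau_1<\tau_2<1$ and $0<\nu<1$; that is, there is a sequence of positive numbers $\{r_k\}_{k\ge 0}$ with $r_0=1$ and $\tau_1 r_{k-1}\le r_k\le\tau_2 r_{k-1}$ for all $k\ge1$, such that $$\frac{H^{n-1}(\partial B_{r_k}\cap\Omega^c)}{r_k^{n-1}}\ge\nu\qquad\text{for all }k\ge0,$$ where $H^{n-1}$ is the $(n-1)$-dimensional Hausdorff measure. Let $n/2<p\le\infty$ and $\alpha>0$ (with $n/p=0$ if $p=\infty$), let $f\in L^p(\Omega)$, and let $g:\partial\Omega\to\mathbb R$ be $C^\alpha$ at $0$, i.e. the quantity $$[g]_{C^\alpha(0)}=\inf\{K\ge0:\ |g(x)-g(0)|\le K|x|^\alpha\ \text{for all }x\in\partial\Omega\}$$ is finite. Let $u\in C(\overline\Omega)$ satisfy $\Delta u=f$ in $\Omega$ in the sense of distributions and $u=g$ on $\partial\Omega$. Then there are constants $\beta_0>0$, depending only on $n,\tau_1,\tau_2,\nu$,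 and $C>0$, depending only on $n,\tau_2,\nu,p$, such that for every $\beta$ with $0<\beta\le\min(\beta_0,\,2-n/p,\,\alpha)$ the function $u$ is $C^\beta$ at $0$ (i.e. $|u(x)-u(0)|\le K|x|^\beta$ for all $x\in\overline\Omega$ and some constant $K$), and $$|u(x)-u(0)|\le C|x|^\beta\left(\|u\|_{L^\infty(\Omega\cap B_1)}+\|f\|_{L^p(\Omega\cap B_1)}+[g]_{C^\alpha(0)}\right)\qquad\text{for all }x\in\Omega\cap B_1.$$ -/

import Mathlib

open MeasureTheory Set
open scoped ENNReal ContDiff Laplacian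

/-- A bounded domain: a nonempty, open, connected, bounded set. -/
structure IsBoundedDomain {n : ℕ} (Ω : Set (EuclideanSpace ℝ (Fin n))) : Prop where
  isOpen : IsOpen Ω
  isConnected : IsConnected Ω
  isBounded : Bornology.IsBounded Ω

/-- `r` is a quasi-geometric sequence with constants `0 < τ₁ < τ₂ < 1`. -/
structure IsQuasiGeometric (τ₁ τ₂ : ℝ) (r : ℕ → ℝ) : Prop where
  tau_pos : 0 < τ₁
  tau_lt : τ₁ < τ₂
  tau_lt_one : τ₂ < 1
  pos : ∀ k, 0 < r k
  lower : ∀ k, τ₁ * r k ≤ r (k + 1)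
  upper : ∀ k, r (k + 1) ≤ τ₂ * r k

/-- The exterior sphere-portion condition (H1) for `Ω` at the boundary point `x₀`, with constants
`τ₁, τ₂, ν` and normalization `r₀ = 1`. Here `μHE[n - 1]` is the `(n - 1)`-dimensional Hausdorff
measure with the usual normalization (Lebesgue measure on `(n - 1)`-dimensional subspaces). -/
def SatisfiesH1 {n : ℕ} (Ω : Set (EuclideanSpace ℝ (Fin n))) (x₀ : EuclideanSpace ℝ (Fin n))
    (τ₁ τ₂ ν : ℝ) : Prop :=
  x₀ ∈ frontier Ω ∧ 0 < ν ∧ ν < 1 ∧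
    ∃ r : ℕ → ℝ, IsQuasiGeometric τ₁ τ₂ r ∧ r 0 = 1 ∧
      ∀ k, ENNReal.ofReal ν ≤
        μHE[n - 1] (Metric.sphere x₀ (r k) ∩ Ωᶜ) / ENNReal.ofReal (r k ^ (n - 1))

/-- `h`, considered as a function on the set `s`, is `C^α` at the point `x₀`. -/
def IsHolderAt {n : ℕ} (s : Set (EuclideanSpace ℝ (Fin n))) (α : ℝ)
    (h : EuclideanSpace ℝ (Fin n) → ℝ) (x₀ : EuclideanSpace ℝ (Fin n)) : Prop :=
  ∃ K : ℝ, ∀ x ∈ s, |h x - h x₀| ≤ K * ‖x - x₀‖ ^ α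

/-- The seminorm `[h]_{C^α(x₀)}` of a function on `s`: the least `K ≥ 0` with
`|h x - h x₀| ≤ K |x - x₀| ^ α` on `s`. -/
noncomputable def holderSeminormAt {n : ℕ} (s : Set (EuclideanSpace ℝ (Fin n))) (α : ℝ)
    (h : EuclideanSpace ℝ (Fin n) → ℝ) (x₀ : EuclideanSpace ℝ (Fin n)) : ℝ :=
  sInf {K : ℝ | 0 ≤ K ∧ ∀ x ∈ s, |h x - h x₀| ≤ K * ‖x - x₀‖ ^ α}

/-- `u ∈ C(Ω̄)` solves the Dirichlet problem `Δ u = f` in `Ω`, `u = g` on `∂Ω`; the equation is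
understood in the sense of distributions, the boundary condition pointwise. -/
structure IsDirichletSolution {n : ℕ} (Ω : Set (EuclideanSpace ℝ (Fin n)))
    (f g u : EuclideanSpace ℝ (Fin n) → ℝ) : Prop where
  continuousOn : ContinuousOn u (closure Ω)
  equation : ∀ φ : EuclideanSpace ℝ (Fin n) → ℝ, ContDiff ℝ ∞ φ → HasCompactSupport φ →
    tsupport φ ⊆ Ω → ∫ x in Ω, u x * (Δ φ) x = ∫ x in Ω, f x * φ x
  boundary : ∀ x ∈ frontier Ω, u x = g x

/-- The `L^p(s)` norm, `1 ≤ p ≤ ∞`, with respect to Lebesgue measure (essential supremum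
for `p = ∞`), as a real number. -/
noncomputable def lpNormOn {n : ℕ} (p : ℝ≥0∞) (s : Set (EuclideanSpace ℝ (Fin n)))
    (h : EuclideanSpace ℝ (Fin n) → ℝ) : ℝ :=
  (eLpNorm h p (volume.restrict s)).toReal

/-! The proof compares u with a barrier on concentric balls and iterates. Let c = u 0 and suppose |u
- c| ≤ M on Ω ∩ B_r and |u - c| ≤ G on the part of ∂Ω in the closed ball of radius r. Let b be a
normalized Poisson integral over E = ∂B_r ∩ Ωᶜ. It is harmonic, lies between 0 and 1, tends to 0 at
points of the sphere inside Ω, and is at least `decayGain` times 1 on B_{τr}, because E has area at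
least ν r^(n-1) (`exists_harmonic_barrier`). Then u - c + M b - M - G has nonpositive boundary
limits on Ω ∩ B_r, so the maximum principle bounds u - c on Ω ∩ B_{τr} by (1 - `decayGain`) M + G +
A r^(2-n/p) ‖f‖_p. Applying this to u and -u gives `HasOscillationDecay`.

Since Δu = f holds only in the distributional sense and f is only in L^p, the maximum principle is
applied to a mollification U = u * φ, for which ΔU = f * φ pointwise. A potential V with ΔV ≥ |f *
φ| is added. It is built from |f| and a regularized fundamental solution, and Hölder's inequality
with p > n/2 bounds it uniformly in the mollification scale (`exists_potential`). Then U + V plus a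
harmonic function has nonnegative Laplacian (`add_le_of_distributional_laplacian`). Pointwise
Laplacians are limits of second differences: this notion is additive, passes under integrals and has
a sign at maxima.

For the iteration, let γ be the gain capped at 1/2. For β ≤ `holderExponent`, passing from r_k to
r_{k+1} ≥ τ₁ r_k shrinks r_k^β by at most the factor 1 + γ/2, less than the oscillation contracts,
so a bound B r_k^β propagates once B is large compared with (G + A ‖f‖_p)/γ. Any x in the unit ball
then lies between two consecutive radii. The ratio τ₁ affects only the exponent, not C. -/

open Filter Topology

/-! ### Pointwise Laplacians as limits of second differences, and the weak maximum principle. -/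

section SecondDifferences

variable {n : ℕ}

local notation "𝔼" => EuclideanSpace ℝ (Fin n)

/-- The discrete Laplacian of `Φ` at `x` with step `t`. -/
noncomputable def secondDiff (Φ : EuclideanSpace ℝ (Fin n) → ℝ) (x : EuclideanSpace ℝ (Fin n))
    (t : ℝ) : ℝ :=
  ∑ i, (Φ (x + t • EuclideanSpace.single i 1) + Φ (x - t • EuclideanSpace.single i 1) - 2 * Φ x)
    / t ^ 2

/-- `Φ` has the pointwise Laplacian `a` at `x`, as the limit of its discrete Laplacians. -/
def HasLap (Φ : EuclideanSpace ℝ (Fin n) → ℝ) (x : EuclideanSpace ℝ (Fin n)) (a : ℝ) : Prop :=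
  Tendsto (secondDiff Φ x) (𝓝[≠] 0) (𝓝 a)

theorem HasLap.add {Φ Ψ : 𝔼 → ℝ} {x : 𝔼} {a b : ℝ} (h₁ : HasLap Φ x a) (h₂ : HasLap Ψ x b) :
    HasLap (fun y => Φ y + Ψ y) x (a + b) := by
  refine (Tendsto.add h₁ h₂).congr fun t => ?_
  simp only [secondDiff, ← Finset.sum_add_distrib]
  exact Finset.sum_congr rfl fun i _ => by ring

theorem HasLap.const_mul {Φ : 𝔼 → ℝ} {x : 𝔼} {a : ℝ} (c : ℝ) (h : HasLap Φ x a) :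
    HasLap (fun y => c * Φ y) x (c * a) := by
  refine (Tendsto.const_mul c h).congr fun t => ?_
  simp only [secondDiff, Finset.mul_sum]
  exact Finset.sum_congr rfl fun i _ => by ring

theorem hasLap_const (c : ℝ) (x : 𝔼) : HasLap (fun _ => c) x 0 := by
  refine tendsto_const_nhds.congr fun t => ?_
  simp only [secondDiff]
  exact (Finset.sum_eq_zero fun i _ => by ring).symm

theorem HasLap.add_const {Φ : 𝔼 → ℝ} {x : 𝔼} {a : ℝ} (h : HasLap Φ x a) (c : ℝ) :
    HasLap (fun y => Φ y + c) x a := by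
  simpa using h.add (hasLap_const c x)

theorem HasLap.unique {Φ : 𝔼 → ℝ} {x : 𝔼} {a b : ℝ} (h₁ : HasLap Φ x a) (h₂ : HasLap Φ x b) :
    a = b := tendsto_nhds_unique h₁ h₂

theorem HasLap.comp_const_sub {Φ : 𝔼 → ℝ} {x y : 𝔼} {a : ℝ} (h : HasLap Φ (x - y) a) :
    HasLap (fun z => Φ (x - z)) y a := by
  refine Tendsto.congr (fun t => ?_) h
  simp only [secondDiff]
  refine Finset.sum_congr rfl fun i _ => ?_
  rw [show x - (y + t • EuclideanSpace.single i 1) = x - y - t • EuclideanSpace.single i 1 by abel,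
    show x - (y - t • EuclideanSpace.single i 1) = x - y + t • EuclideanSpace.single i 1 by abel,
    add_comm (Φ (x - y + _))]

theorem HasLap.comp_sub_const {Φ : 𝔼 → ℝ} {x y : 𝔼} {a : ℝ} (h : HasLap Φ (x - y) a) :
    HasLap (fun z => Φ (z - y)) x a := by
  refine Tendsto.congr (fun t => ?_) h
  simp only [secondDiff]
  refine Finset.sum_congr rfl fun i _ => ?_
  rw [show x + t • EuclideanSpace.single i 1 - y = x - y + t • EuclideanSpace.single i 1 by abel,
    show x - t • EuclideanSpace.single i 1 - y = x - y - t • EuclideanSpace.single i 1 by abel]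

/-- The symmetric second difference quotient converges to the second derivative. -/
theorem tendsto_second_difference {g g' : ℝ → ℝ} {c : ℝ}
    (hg : ∀ᶠ t in 𝓝 0, HasDerivAt g (g' t) t) (hg' : HasDerivAt g' c 0) :
    Tendsto (fun t => (g t + g (-t) - 2 * g 0) / t ^ 2) (𝓝[≠] 0) (𝓝 c) := by
  have hneg : Tendsto (fun t : ℝ => -t) (𝓝 0) (𝓝 0) := by
    simpa using (continuous_neg (G := ℝ)).tendsto 0
  have hc := hg.self_of_nhds.continuousAt
  -- One use of l'Hôpital leaves (g' t - g' (-t)) / (2t), a difference quotient at 0, so g' need be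
  -- differentiable only at 0.
  refine HasDerivAt.lhopital_zero_nhdsNE (f' := fun t => g' t - g' (-t)) (g' := fun t => 2 * t)
    ?_ ?_ ?_ ?_ ?_ ?_
  · filter_upwards [nhdsWithin_le_nhds (hg.and (hneg.eventually hg))] with t ht
    have h2 : HasDerivAt (fun s => g (-s)) (-(g' (-t))) t :=
      (ht.2.scomp t (hasDerivAt_neg t)).congr_deriv (by simp)
    exact ((ht.1.fun_add h2).sub_const (2 * g 0)).congr_deriv (by ring)
  · exact Eventually.of_forall fun t => by simpa using hasDerivAt_pow 2 t
  · filter_upwards [self_mem_nhdsWithin] with t ht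
    simpa using ht
  · have : Tendsto (fun t => g t + g (-t) - 2 * g 0) (𝓝 0) (𝓝 (g 0 + g 0 - 2 * g 0)) :=
      (hc.tendsto.add (hc.tendsto.comp hneg)).sub_const _
    rw [show g 0 + g 0 - 2 * g 0 = 0 by ring] at this
    exact this.mono_left nhdsWithin_le_nhds
  · have : Tendsto (fun t : ℝ => t ^ 2) (𝓝 0) (𝓝 (0 ^ 2)) := (continuous_pow 2).tendsto 0
    simpa using this.mono_left nhdsWithin_le_nhds
  · have h1 : HasDerivAt (fun t => g' t - g' (-t)) (c + c) 0 := by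
      have h2 : HasDerivAt (fun s => g' (-s)) (-c) 0 := by
        have h3 : HasDerivAt g' c (-0) := by simpa using hg'
        exact (h3.scomp (0 : ℝ) (hasDerivAt_neg 0)).congr_deriv (by simp)
      exact (hg'.fun_sub h2).congr_deriv (by ring)
    have h3 := (hasDerivAt_iff_tendsto_slope.1 h1).const_mul (1 / 2)
    rw [show 1 / 2 * (c + c) = c by ring] at h3
    refine h3.congr fun t => ?_
    simp only [slope, vsub_eq_sub, smul_eq_mul, neg_zero, sub_self, sub_zero]
    simp only [div_eq_mul_inv, mul_inv]
    ring

theorem hasLap_of_lines {Φ : 𝔼 → ℝ} {x : 𝔼} {g' : Fin n → ℝ → ℝ} {c : Fin n → ℝ}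
    (h : ∀ i, ∀ᶠ t in 𝓝 (0 : ℝ),
      HasDerivAt (fun s : ℝ => Φ (x + s • EuclideanSpace.single i 1)) (g' i t) t)
    (h' : ∀ i, HasDerivAt (g' i) (c i) 0) : HasLap Φ x (∑ i, c i) := by
  refine tendsto_finsetSum _ fun i _ => ?_
  simpa [sub_eq_add_neg] using tendsto_second_difference (h i) (h' i)

/-- The link between second differences and the operator `Δ` of the distributional equation: along
each coordinate line the second derivative is a diagonal entry of the Hessian. -/
theorem ContDiff.hasLap {φ : 𝔼 → ℝ} (hφ : ContDiff ℝ 2 φ) (x : 𝔼) : HasLap φ x (Δ φ x) := by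
  have hb := congrFun (InnerProductSpace.laplacian_eq_iteratedFDeriv_orthonormalBasis φ
    (EuclideanSpace.basisFun (Fin n) ℝ)) x
  rw [hb]
  have hd : Differentiable ℝ φ := hφ.differentiable (by norm_num)
  have hd' : Differentiable ℝ (fderiv ℝ φ) :=
    (hφ.fderiv_right (m := 1) (by norm_num)).differentiable (by norm_num)
  have hl : ∀ (i : Fin n) (t : ℝ), HasDerivAt (fun s : ℝ => x + s • EuclideanSpace.single i (1 : ℝ))
      (EuclideanSpace.single i (1 : ℝ) : 𝔼) t := fun i t => by
    simpa using ((hasDerivAt_id t).smul_const (EuclideanSpace.single i (1 : ℝ) : 𝔼)).const_add x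
  refine hasLap_of_lines
    (g' := fun i t => fderiv ℝ φ (x + t • EuclideanSpace.single i 1) (EuclideanSpace.single i 1))
    (fun i => Eventually.of_forall fun t => ?_) (fun i => ?_)
  · exact (hd _).hasFDerivAt.comp_hasDerivAt t (hl i t)
  · have h1 := (hd' (x + (0 : ℝ) • EuclideanSpace.single i (1 : ℝ))).hasFDerivAt.comp_hasDerivAt 0
      (hl i 0)
    have h2 := h1.clm_apply (hasDerivAt_const (0 : ℝ) (EuclideanSpace.single i (1 : ℝ) : 𝔼))
    simpa [iteratedFDeriv_two_apply] using h2

theorem hasDerivAt_norm_sq_line (x : 𝔼) (i : Fin n) (t : ℝ) :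
    HasDerivAt (fun s : ℝ => ‖x + s • EuclideanSpace.single i (1 : ℝ)‖ ^ 2) (2 * x i + 2 * t) t := by
  have h : (fun s : ℝ => ‖x + s • EuclideanSpace.single i (1 : ℝ)‖ ^ 2)
      = fun s => ‖x‖ ^ 2 + 2 * s * x i + s ^ 2 := by
    funext s
    rw [norm_add_sq_real, inner_smul_right, norm_smul]
    simp [EuclideanSpace.inner_single_right]
    ring
  rw [h]
  exact (((((hasDerivAt_id t).const_mul 2).mul_const (x i)).const_add (‖x‖ ^ 2)).fun_add
    (hasDerivAt_pow 2 t)).congr_deriv (by simp)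

/-- The Laplacian of a linear form times a radial function. -/
theorem hasLap_inner_mul_radial {ψ ψ' : ℝ → ℝ} {ψ'' : ℝ} (y x : 𝔼) (b : ℝ)
    (h : ∀ᶠ q in 𝓝 (‖x‖ ^ 2), HasDerivAt ψ (ψ' q) q) (h' : HasDerivAt ψ' ψ'' (‖x‖ ^ 2)) :
    HasLap (fun z => (inner ℝ y z + b) * ψ (‖z‖ ^ 2)) x
      ((inner ℝ y x + b) * (4 * ‖x‖ ^ 2 * ψ'' + 2 * n * ψ' (‖x‖ ^ 2))
        + 4 * inner ℝ y x * ψ' (‖x‖ ^ 2)) := by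
  have hq := hasDerivAt_norm_sq_line x
  have hin : ∀ i (t : ℝ), HasDerivAt
      (fun s : ℝ => inner ℝ y (x + s • EuclideanSpace.single i (1 : ℝ)) + b) (y i) t := by
    intro i t
    have e : (fun s : ℝ => inner ℝ y (x + s • EuclideanSpace.single i (1 : ℝ)) + b)
        = fun s => inner ℝ y x + s * y i + b := by
      funext s
      simp [inner_add_right, inner_smul_right, EuclideanSpace.inner_single_right]
    rw [e]
    simpa using ((((hasDerivAt_id t).mul_const (y i)).const_add (inner ℝ y x)).add_const b)
  have key := hasLap_of_lines (Φ := fun z => (inner ℝ y z + b) * ψ (‖z‖ ^ 2)) (x := x)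
    (g' := fun i t => y i * ψ (‖x + t • EuclideanSpace.single i (1 : ℝ)‖ ^ 2) +
      (inner ℝ y (x + t • EuclideanSpace.single i (1 : ℝ)) + b) *
        (ψ' (‖x + t • EuclideanSpace.single i (1 : ℝ)‖ ^ 2) * (2 * x i + 2 * t)))
    (c := fun i => y i * (ψ' (‖x‖ ^ 2) * (2 * x i)) + (y i * (ψ' (‖x‖ ^ 2) * (2 * x i)) +
      (inner ℝ y x + b) * (ψ'' * (2 * x i) * (2 * x i) + ψ' (‖x‖ ^ 2) * 2))) ?_ ?_
  · convert key using 1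
    have e1 : inner ℝ y x = ∑ i, y i * x i := by
      simp [PiLp.inner_apply, mul_comm]
    have e2 : ‖x‖ ^ 2 = ∑ i, x i * x i := by
      rw [EuclideanSpace.norm_sq_eq]; simp [sq]
    have e3 : ∀ i, y i * (ψ' (‖x‖ ^ 2) * (2 * x i)) + (y i * (ψ' (‖x‖ ^ 2) * (2 * x i)) +
      (inner ℝ y x + b) * (ψ'' * (2 * x i) * (2 * x i) + ψ' (‖x‖ ^ 2) * 2))
      = 4 * ψ' (‖x‖ ^ 2) * (y i * x i) + (4 * (inner ℝ y x + b) * ψ'') * (x i * x i) +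
        2 * (inner ℝ y x + b) * ψ' (‖x‖ ^ 2) := fun i => by ring
    simp_rw [e3, Finset.sum_add_distrib, ← Finset.mul_sum]
    rw [← e1, ← e2]
    simp
    ring
  · intro i
    have hcont : Tendsto (fun s : ℝ => ‖x + s • EuclideanSpace.single i (1 : ℝ)‖ ^ 2) (𝓝 0)
        (𝓝 (‖x‖ ^ 2)) := by
      simpa using (hq i 0).continuousAt.tendsto
    filter_upwards [hcont.eventually h] with t ht
    exact (hin i t).mul (ht.comp t (hq i t))
  · intro i
    have h0 : ‖x + (0 : ℝ) • EuclideanSpace.single i (1 : ℝ)‖ ^ 2 = ‖x‖ ^ 2 := by simp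
    have h1 : HasDerivAt ψ (ψ' (‖x‖ ^ 2)) (‖x + (0 : ℝ) • EuclideanSpace.single i (1 : ℝ)‖ ^ 2) := by
      rw [h0]; exact h.self_of_nhds
    have h2 : HasDerivAt ψ' ψ'' (‖x + (0 : ℝ) • EuclideanSpace.single i (1 : ℝ)‖ ^ 2) := by
      rw [h0]; exact h'
    have l : HasDerivAt (fun t : ℝ => 2 * x i + 2 * t) 2 0 := by
      simpa using ((hasDerivAt_id (0 : ℝ)).const_mul 2).const_add (2 * x i)
    exact (((h1.comp 0 (hq i 0)).const_mul (y i)).fun_add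
      ((hin i 0).fun_mul ((h2.comp 0 (hq i 0)).fun_mul l))).congr_deriv (by simp)

theorem hasLap_radial {ψ ψ' : ℝ → ℝ} {ψ'' : ℝ} (x : 𝔼)
    (h : ∀ᶠ q in 𝓝 (‖x‖ ^ 2), HasDerivAt ψ (ψ' q) q) (h' : HasDerivAt ψ' ψ'' (‖x‖ ^ 2)) :
    HasLap (fun z => ψ (‖z‖ ^ 2)) x (4 * ‖x‖ ^ 2 * ψ'' + 2 * n * ψ' (‖x‖ ^ 2)) := by
  simpa using hasLap_inner_mul_radial 0 x 1 h h'

theorem hasLap_norm_sq (x : 𝔼) : HasLap (fun z => ‖z‖ ^ 2) x (2 * n) := by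
  simpa using hasLap_radial (ψ := id) (ψ' := fun _ => 1) (ψ'' := 0) x
    (Eventually.of_forall fun q => hasDerivAt_id q) (hasDerivAt_const _ _)

theorem HasLap.nonpos_of_isMax {Φ : 𝔼 → ℝ} {x : 𝔼} {a : ℝ} (h : HasLap Φ x a)
    (hx : IsLocalMax Φ x) : a ≤ 0 := by
  refine le_of_tendsto h ?_
  have hlim : ∀ (s : ℝ) (i : Fin n), Tendsto
      (fun t : ℝ => x + (s * t) • (EuclideanSpace.single i 1 : 𝔼)) (𝓝 0) (𝓝 x) := fun s i => by
    have : Continuous fun t : ℝ => x + (s * t) • (EuclideanSpace.single i 1 : 𝔼) := by fun_prop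
    simpa using this.tendsto 0
  have h1 : ∀ᶠ t : ℝ in 𝓝 0, ∀ i : Fin n,
      Φ (x + t • EuclideanSpace.single i 1) ≤ Φ x ∧ Φ (x - t • EuclideanSpace.single i 1) ≤ Φ x := by
    rw [eventually_all]
    intro i
    filter_upwards [(hlim 1 i).eventually hx, (hlim (-1) i).eventually hx] with t h1 h2
    constructor
    · simpa using h1
    · simpa [sub_eq_add_neg] using h2
  filter_upwards [nhdsWithin_le_nhds h1] with t ht
  exact Finset.sum_nonpos fun i _ => div_nonpos_of_nonpos_of_nonneg
    (by linarith [(ht i).1, (ht i).2]) (sq_nonneg t)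

/-- The weak maximum principle for functions with nonnegative pointwise Laplacian. -/
theorem le_of_hasLap_nonneg (hn : 0 < n) {K : Set 𝔼} (hK : IsCompact K) {Φ : 𝔼 → ℝ}
    (hΦ : ContinuousOn Φ K) (hlap : ∀ x ∈ interior K, ∃ a, 0 ≤ a ∧ HasLap Φ x a) {B : ℝ}
    (hB : ∀ x ∈ K \ interior K, Φ x ≤ B) : ∀ x ∈ K, Φ x ≤ B := by
  intro x hx
  obtain ⟨R, hR⟩ := hK.isBounded.exists_norm_le
  -- Adding s‖y‖² makes the Laplacian strictly positive, which excludes an interior maximum; then s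
  -- tends to 0.
  have key : ∀ s > 0, Φ x ≤ B + s * R ^ 2 := by
    intro s hs
    obtain ⟨m, hm, hmax⟩ := hK.exists_isMaxOn ⟨x, hx⟩
      (hΦ.add (by fun_prop : ContinuousOn (fun y : 𝔼 => s * ‖y‖ ^ 2) K))
    have hxm : Φ x + s * ‖x‖ ^ 2 ≤ Φ m + s * ‖m‖ ^ 2 := hmax hx
    have hmi : m ∉ interior K := by
      intro hmi
      obtain ⟨a, ha, hl⟩ := hlap m hmi
      have h1 := hl.add ((hasLap_norm_sq m).const_mul s)
      have h2 := h1.nonpos_of_isMax (hmax.isLocalMax (mem_interior_iff_mem_nhds.1 hmi))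
      have : 0 < s * (2 * n) := by positivity
      linarith
    have h1 := hB m ⟨hm, hmi⟩
    have h2 : ‖m‖ ^ 2 ≤ R ^ 2 := pow_le_pow_left₀ (norm_nonneg _) (hR m hm) 2
    nlinarith [sq_nonneg ‖x‖, mul_le_mul_of_nonneg_left h2 hs.le, mul_nonneg hs.le (sq_nonneg ‖x‖)]
  have hlim : Tendsto (fun s : ℝ => B + s * R ^ 2) (𝓝[>] 0) (𝓝 B) := by
    have : Continuous fun s : ℝ => B + s * R ^ 2 := by fun_prop
    simpa using (this.tendsto 0).mono_left nhdsWithin_le_nhds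
  exact ge_of_tendsto hlim (eventually_mem_nhdsWithin.mono key)

end SecondDifferences

/-! ### Continuity and Laplacians of integrals depending on a parameter. -/

section ParametricIntegrals

variable {n : ℕ}

local notation "𝔼" => EuclideanSpace ℝ (Fin n)

/-- The map s ↦ k (b + s v) + k (b - s v) has derivative (Dk(b + s v) - Dk(b - s v)) v, which is
O(|s|) because Dk is locally Lipschitz; the mean value inequality does the rest. Uniformity in b and
v supplies the dominating function for taking Laplacians under the integral. -/
theorem ContDiffAt.exists_second_difference_bound {F : Type*} [NormedAddCommGroup F]
    [NormedSpace ℝ F] {k : F → ℝ} {a : F} (hk : ContDiffAt ℝ 2 k a) :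
    ∃ C : ℝ, ∃ ρ > 0, ∀ b ∈ Metric.ball a ρ, ∀ v : F, ‖v‖ ≤ 1 → ∀ t : ℝ, |t| < ρ →
      |k (b + t • v) + k (b - t • v) - 2 * k b| ≤ C * t ^ 2 := by
  have h1 : ContDiffAt ℝ 1 (fderiv ℝ k) a := hk.fderiv_right (by norm_num)
  obtain ⟨L, s, hs, hL⟩ := h1.exists_lipschitzOnWith
  have h2 : ∀ᶠ b in 𝓝 a, DifferentiableAt ℝ k b :=
    (hk.eventually (by simp)).mono fun b hb => hb.differentiableAt (by norm_num)
  obtain ⟨ρ, hρ, hball⟩ := Metric.mem_nhds_iff.1 (inter_mem hs h2)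
  refine ⟨2 * L, ρ / 2, by positivity, fun b hb v hv t ht => ?_⟩
  have hmem : ∀ s : ℝ, |s| ≤ |t| → b + s • v ∈ Metric.ball a ρ := fun s hs => by
    rw [Metric.mem_ball, dist_eq_norm] at hb ⊢
    calc ‖b + s • v - a‖ = ‖(b - a) + s • v‖ := by congr 1; abel
      _ ≤ ‖b - a‖ + |s| * ‖v‖ := by
        refine (norm_add_le _ _).trans ?_
        rw [norm_smul, Real.norm_eq_abs]
      _ ≤ ‖b - a‖ + |t| * 1 := by gcongr
      _ < ρ := by linarith
  have hder : ∀ s ∈ Icc (-|t|) |t|, HasDerivWithinAt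
      (fun s : ℝ => k (b + s • v) + k (b + (-s) • v))
      (fderiv ℝ k (b + s • v) v - fderiv ℝ k (b + (-s) • v) v) (Icc (-|t|) |t|) s := by
    intro s hs
    have hs' : |s| ≤ |t| := abs_le.2 hs
    have e1 : HasDerivAt (fun s : ℝ => b + s • v) v s := by
      simpa using ((hasDerivAt_id s).smul_const v).const_add b
    have e2 : HasDerivAt (fun s : ℝ => b + (-s) • v) (-v) s := by
      simpa using ((hasDerivAt_neg s).smul_const v).const_add b
    have d1 := (hball (hmem s hs')).2.hasFDerivAt.comp_hasDerivAt s e1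
    have d2 := (hball (hmem (-s) (by simpa using hs'))).2.hasFDerivAt.comp_hasDerivAt s e2
    exact ((d1.fun_add d2).congr_deriv (by simp [sub_eq_add_neg])).hasDerivWithinAt
  have hbound : ∀ s ∈ Icc (-|t|) |t|,
      ‖fderiv ℝ k (b + s • v) v - fderiv ℝ k (b + (-s) • v) v‖ ≤ 2 * L * |t| := by
    intro s hs
    have hs' : |s| ≤ |t| := abs_le.2 hs
    have hl := hL.dist_le_mul _ (hball (hmem s hs')).1 _ (hball (hmem (-s) (by simpa using hs'))).1
    rw [dist_eq_norm, dist_eq_norm] at hl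
    have e : b + s • v - (b + (-s) • v) = (2 * s) • v := by
      rw [two_mul, add_smul, neg_smul]; abel
    rw [e, norm_smul] at hl
    calc _ = ‖(fderiv ℝ k (b + s • v) - fderiv ℝ k (b + (-s) • v)) v‖ := by simp
      _ ≤ ‖fderiv ℝ k (b + s • v) - fderiv ℝ k (b + (-s) • v)‖ * ‖v‖ :=
        ContinuousLinearMap.le_opNorm _ _
      _ ≤ (L * (‖2 * s‖ * ‖v‖)) * ‖v‖ := by gcongr
      _ ≤ (L * (2 * |t| * 1)) * 1 := by
        have : ‖2 * s‖ ≤ 2 * |t| := by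
          rw [norm_mul, Real.norm_eq_abs, Real.norm_eq_abs, abs_two]; gcongr
        gcongr
      _ = _ := by ring
  have := (convex_Icc (-|t|) |t|).norm_image_sub_le_of_norm_hasDerivWithin_le hder hbound
    (x := 0) (y := t) (by simp) ⟨neg_abs_le t, le_abs_self t⟩
  simp only [zero_smul, neg_zero, add_zero, neg_smul, sub_zero, Real.norm_eq_abs,
    ← sub_eq_add_neg] at this
  calc _ = |k (b + t • v) + k (b - t • v) - (k b + k b)| := by congr 1; ring
    _ ≤ 2 * L * |t| * |t| := this
    _ = 2 * L * t ^ 2 := by rw [mul_assoc, abs_mul_abs_self, sq]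

theorem IsCompact.exists_second_difference_bound {F : Type*} [NormedAddCommGroup F]
    [NormedSpace ℝ F] {k : F → ℝ} {A : Set F} (hA : IsCompact A)
    (hk : ∀ a ∈ A, ContDiffAt ℝ 2 k a) :
    ∃ C : ℝ, ∃ ρ > 0, ∀ b ∈ A, ∀ v : F, ‖v‖ ≤ 1 → ∀ t : ℝ, |t| < ρ →
      |k (b + t • v) + k (b - t • v) - 2 * k b| ≤ C * t ^ 2 := by
  refine hA.induction_on (p := fun S => ∃ C : ℝ, ∃ ρ > 0, ∀ b ∈ S, ∀ v : F, ‖v‖ ≤ 1 → ∀ t : ℝ,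
    |t| < ρ → |k (b + t • v) + k (b - t • v) - 2 * k b| ≤ C * t ^ 2) ?_ ?_ ?_ ?_
  · exact ⟨0, 1, one_pos, by simp⟩
  · rintro s t hst ⟨C, ρ, hρ, h⟩
    exact ⟨C, ρ, hρ, fun b hb => h b (hst hb)⟩
  · rintro s t ⟨C, ρ, hρ, h⟩ ⟨C', ρ', hρ', h'⟩
    refine ⟨max C C', min ρ ρ', lt_min hρ hρ', ?_⟩
    rintro b (hb | hb) v hv r hr
    · exact (h b hb v hv r (hr.trans_le (min_le_left _ _))).trans
        (mul_le_mul_of_nonneg_right (le_max_left _ _) (sq_nonneg r))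
    · exact (h' b hb v hv r (hr.trans_le (min_le_right _ _))).trans
        (mul_le_mul_of_nonneg_right (le_max_right _ _) (sq_nonneg r))
  · intro a ha
    obtain ⟨C, ρ, hρ, h⟩ := (hk a ha).exists_second_difference_bound
    exact ⟨_, mem_nhdsWithin_of_mem_nhds (Metric.ball_mem_nhds a hρ), C, ρ, hρ, h⟩

variable {μ : Measure (EuclideanSpace ℝ (Fin n))} {Y : Set (EuclideanSpace ℝ (Fin n))}
  {O : Set (EuclideanSpace ℝ (Fin n) × EuclideanSpace ℝ (Fin n))}
  {k : EuclideanSpace ℝ (Fin n) × EuclideanSpace ℝ (Fin n) → ℝ}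
  {c : EuclideanSpace ℝ (Fin n) → ℝ} {x : EuclideanSpace ℝ (Fin n)}

theorem eventually_forall_mk_mem (hY : IsCompact Y) (hO : IsOpen O) (hx : ∀ y ∈ Y, (x, y) ∈ O) :
    ∀ᶠ z in 𝓝 x, ∀ y ∈ Y, (z, y) ∈ O :=
  hY.eventually_forall_of_forall_eventually fun y hy => hO.mem_nhds (hx y hy)

theorem exists_bound_kernel (hY : IsCompact Y) (hO : IsOpen O) (hk : ContinuousOn k O)
    (hx : ∀ y ∈ Y, (x, y) ∈ O) : ∃ C : ℝ, ∀ᶠ z in 𝓝 x, ∀ y ∈ Y, |k (z, y)| ≤ C := by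
  have hc : ContinuousOn (fun y => k (x, y)) Y :=
    hk.comp (by fun_prop) hx
  obtain ⟨C, hC⟩ := hY.exists_bound_of_continuousOn hc
  refine ⟨C + 1, hY.eventually_forall_of_forall_eventually fun y hy => ?_⟩
  have h1 := ((hk.continuousAt (hO.mem_nhds (hx y hy))).abs).tendsto
  have h2 : |k (x, y)| < C + 1 := by
    have := hC y hy
    rw [Real.norm_eq_abs] at this
    linarith
  exact (h1.eventually_lt_const h2).mono fun z hz => hz.le

theorem aestronglyMeasurable_kernel (hYm : ∀ᵐ y ∂μ, y ∈ Y) (hY : IsCompact Y)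
    (hk : ContinuousOn k O) (hx : ∀ y ∈ Y, (x, y) ∈ O) :
    AEStronglyMeasurable (fun y => k (x, y)) μ := by
  have hc : ContinuousOn (fun y => k (x, y)) Y := hk.comp (by fun_prop) hx
  have := hc.aestronglyMeasurable (μ := μ) hY.measurableSet
  rwa [Measure.restrict_eq_self_of_ae_mem hYm] at this

theorem integrable_kernel (hYm : ∀ᵐ y ∂μ, y ∈ Y) (hY : IsCompact Y)
    (hk : ContinuousOn k O) (hc : Integrable c μ) (hx : ∀ y ∈ Y, (x, y) ∈ O) :
    Integrable (fun y => c y * k (x, y)) μ := by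
  obtain ⟨C, hC⟩ := hY.exists_bound_of_continuousOn
    (hk.comp (by fun_prop) hx : ContinuousOn (fun y => k (x, y)) Y)
  exact hc.mul_bdd (c := C) (aestronglyMeasurable_kernel hYm hY hk hx) (hYm.mono fun y hy => hC y hy)

theorem continuousAt_integral_kernel (hYm : ∀ᵐ y ∂μ, y ∈ Y) (hY : IsCompact Y) (hO : IsOpen O)
    (hk : ContinuousOn k O) (hc : Integrable c μ) (hx : ∀ y ∈ Y, (x, y) ∈ O) :
    ContinuousAt (fun z => ∫ y, c y * k (z, y) ∂μ) x := by
  obtain ⟨C, hC⟩ := exists_bound_kernel hY hO hk hx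
  refine continuousAt_of_dominated (bound := fun y => |c y| * C) ?_ ?_ (hc.abs.mul_const C) ?_
  · filter_upwards [eventually_forall_mk_mem hY hO hx] with z hz
    exact (integrable_kernel hYm hY hk hc hz).aestronglyMeasurable
  · filter_upwards [hC] with z hz
    filter_upwards [hYm] with y hy
    rw [Real.norm_eq_abs, abs_mul]
    exact mul_le_mul_of_nonneg_left (hz y hy) (abs_nonneg _)
  · filter_upwards [hYm] with y hy
    have h1 : ContinuousAt (fun z => k (z, y)) x :=
      (hk.continuousAt (hO.mem_nhds (hx y hy))).comp (f := fun z => (z, y)) (by fun_prop)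
    exact h1.const_mul (c y)

/-- Differentiation under the integral sign for the pointwise Laplacian. -/
theorem hasLap_integral_kernel (hYm : ∀ᵐ y ∂μ, y ∈ Y) (hY : IsCompact Y) (hO : IsOpen O)
    (hk : ContDiffOn ℝ 2 k O) (hc : Integrable c μ) (hx : ∀ y ∈ Y, (x, y) ∈ O)
    {ℓ : EuclideanSpace ℝ (Fin n) → ℝ} (hℓ : ∀ y ∈ Y, HasLap (fun z => k (z, y)) x (ℓ y)) :
    HasLap (fun z => ∫ y, c y * k (z, y) ∂μ) x (∫ y, c y * ℓ y ∂μ) := by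
  have hA : IsCompact ((fun y => (x, y)) '' Y) := hY.image (by fun_prop)
  -- Compactness of {x} × Y makes the bound uniform in y; summing over n directions, |c| · nC
  -- dominates the integrands.
  obtain ⟨C, ρ, hρ, hC⟩ := hA.exists_second_difference_bound (k := k) (by
    rintro _ ⟨y, hy, rfl⟩
    exact hk.contDiffAt (hO.mem_nhds (hx y hy)))
  have hlim : ∀ (s : ℝ) (i : Fin n), Tendsto
      (fun t : ℝ => x + (s * t) • (EuclideanSpace.single i 1 : 𝔼)) (𝓝 0) (𝓝 x) := fun s i => by
    have : Continuous fun t : ℝ => x + (s * t) • (EuclideanSpace.single i 1 : 𝔼) := by fun_prop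
    simpa using this.tendsto 0
  have hmem : ∀ᶠ t : ℝ in 𝓝[≠] 0, ∀ i : Fin n,
      (∀ y ∈ Y, (x + t • EuclideanSpace.single i 1, y) ∈ O) ∧
      (∀ y ∈ Y, (x - t • EuclideanSpace.single i 1, y) ∈ O) := by
    refine Eventually.filter_mono nhdsWithin_le_nhds (eventually_all.2 fun i => ?_)
    have h := eventually_forall_mk_mem hY hO hx
    filter_upwards [(hlim 1 i).eventually h, (hlim (-1) i).eventually h] with t h1 h2
    exact ⟨by simpa using h1, by simpa [sub_eq_add_neg] using h2⟩
  have heq : ∀ᶠ t : ℝ in 𝓝[≠] 0, (Integrable (fun y => c y * secondDiff (fun z => k (z, y)) x t) μ ∧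
      ∫ y, c y * secondDiff (fun z => k (z, y)) x t ∂μ
        = secondDiff (fun z => ∫ y, c y * k (z, y) ∂μ) x t) := by
    filter_upwards [hmem] with t ht
    have hi := fun z => integrable_kernel (x := z) hYm hY hk.continuousOn hc
    have hI : ∀ i : Fin n, Integrable (fun y => (c y * k (x + t • EuclideanSpace.single i 1, y) +
        c y * k (x - t • EuclideanSpace.single i 1, y) - 2 * (c y * k (x, y))) / t ^ 2) μ := fun i =>
      (((hi _ (ht i).1).add (hi _ (ht i).2)).sub ((hi _ hx).const_mul 2)).div_const _
    have e : (fun y => c y * secondDiff (fun z => k (z, y)) x t) = fun y => ∑ i : Fin n,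
        (c y * k (x + t • EuclideanSpace.single i 1, y) +
        c y * k (x - t • EuclideanSpace.single i 1, y) - 2 * (c y * k (x, y))) / t ^ 2 := by
      funext y
      simp only [secondDiff, Finset.mul_sum]
      exact Finset.sum_congr rfl fun i _ => by ring
    rw [e]
    refine ⟨integrable_finsetSum _ fun i _ => hI i, ?_⟩
    rw [integral_finsetSum _ fun i _ => hI i]
    refine Finset.sum_congr rfl fun i _ => ?_
    rw [integral_div, integral_sub, integral_add (hi _ (ht i).1) (hi _ (ht i).2),
      integral_const_mul]
    · exact (hi _ (ht i).1).add (hi _ (ht i).2)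
    · exact (hi _ hx).const_mul 2
  refine Tendsto.congr' (heq.mono fun t ht => ht.2) ?_
  refine tendsto_integral_filter_of_dominated_convergence (fun y => |c y| * (n * C)) ?_ ?_
    (hc.abs.mul_const _) ?_
  · exact heq.mono fun t ht => ht.1.aestronglyMeasurable
  · have hsmall : ∀ᶠ t : ℝ in 𝓝[≠] 0, |t| < ρ := by
      refine Eventually.filter_mono nhdsWithin_le_nhds ?_
      simpa using (continuous_abs.tendsto (0 : ℝ)).eventually_lt_const (by simpa using hρ)
    filter_upwards [hsmall, self_mem_nhdsWithin] with t ht ht0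
    filter_upwards [hYm] with y hy
    have ht2 : 0 < t ^ 2 := by have : t ≠ 0 := ht0; positivity
    rw [norm_mul, Real.norm_eq_abs, Real.norm_eq_abs]
    refine mul_le_mul_of_nonneg_left ?_ (abs_nonneg _)
    calc |secondDiff (fun z => k (z, y)) x t| ≤ ∑ i : Fin n, C := by
          refine (Finset.abs_sum_le_sum_abs _ _).trans (Finset.sum_le_sum fun i _ => ?_)
          rw [abs_div, abs_of_pos ht2, div_le_iff₀ ht2]
          have := hC (x, y) ⟨y, hy, rfl⟩ (EuclideanSpace.single i 1, 0) (by simp [Prod.norm_def]) t ht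
          simpa using this
      _ = n * C := by simp
  · filter_upwards [hYm] with y hy
    exact Tendsto.const_mul (c y) (hℓ y hy)

end ParametricIntegrals

/-! ### Finiteness and scaling of the surface measure of spheres. -/

section SphereMeasure

variable {n : ℕ}

local notation "𝔼" => EuclideanSpace ℝ (Fin n)

theorem norm_normalize_sub_le {V : Type*} [NormedAddCommGroup V] [NormedSpace ℝ V] {a b : V}
    (ha : 1 ≤ ‖a‖) (hb : 1 ≤ ‖b‖) : ‖‖a‖⁻¹ • a - ‖b‖⁻¹ • b‖ ≤ 2 * ‖a - b‖ := by
  have e : ‖a‖⁻¹ • a - ‖b‖⁻¹ • b = ‖a‖⁻¹ • (a - b) + (‖a‖⁻¹ - ‖b‖⁻¹) • b := by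
    rw [smul_sub, sub_smul]; abel
  have ha0 : 0 < ‖a‖ := by linarith
  have hb0 : 0 < ‖b‖ := by linarith
  have h1 : ‖a‖⁻¹ ≤ 1 := inv_le_one_of_one_le₀ ha
  have h2 : |‖a‖⁻¹ - ‖b‖⁻¹| * ‖b‖ = ‖a‖⁻¹ * |‖b‖ - ‖a‖| := by
    have : ‖a‖⁻¹ - ‖b‖⁻¹ = ‖a‖⁻¹ * (‖b‖ - ‖a‖) * ‖b‖⁻¹ := by field_simp
    rw [this, abs_mul, abs_mul, abs_of_pos (inv_pos.2 ha0), abs_of_pos (inv_pos.2 hb0)]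
    field_simp
  rw [e]
  calc _ ≤ ‖a‖⁻¹ * ‖a - b‖ + |‖a‖⁻¹ - ‖b‖⁻¹| * ‖b‖ := by
        refine (norm_add_le _ _).trans ?_
        rw [norm_smul, norm_smul, Real.norm_eq_abs, Real.norm_eq_abs, abs_of_pos (inv_pos.2 ha0)]
    _ ≤ 1 * ‖a - b‖ + 1 * ‖a - b‖ := by
        rw [h2]
        gcongr
        rw [norm_sub_rev a b]
        exact abs_norm_sub_norm_le b a
    _ = _ := by ring

/-- By compactness it suffices to treat the cap ⟨v, y⟩ > 1/2 around each v. It lies in the image of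
a ball of radius 2 in the hyperplane v^⊥ under w ↦ (v + w)/‖v + w‖, which is 2-Lipschitz because ‖v
+ w‖ ≥ 1; the preimage of y is y/⟨v, y⟩ - v. -/
theorem euclideanHausdorffMeasure_sphere_lt_top (hn : 1 ≤ n) :
    μHE[n - 1] (Metric.sphere (0 : 𝔼) 1) < ⊤ := by
  refine (isCompact_sphere (0 : 𝔼) 1).measure_lt_top_of_nhdsWithin fun v hv => ?_
  have hv1 : ‖v‖ = 1 := by simpa using hv
  obtain ⟨m, rfl⟩ : ∃ m, n = m + 1 := ⟨n - 1, by omega⟩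
  have : Fact (Module.finrank ℝ (EuclideanSpace ℝ (Fin (m + 1))) = m + 1) := ⟨by simp⟩
  have hfr : Module.finrank ℝ (ℝ ∙ v)ᗮ = m :=
    Submodule.finrank_orthogonal_span_singleton (by rintro rfl; simp at hv1)
  have hinner : ∀ w ∈ (ℝ ∙ v)ᗮ, inner ℝ v w = 0 := fun w hw =>
    Submodule.mem_orthogonal_singleton_iff_inner_right.1 hw
  have hnorm : ∀ w : (ℝ ∙ v)ᗮ, 1 ≤ ‖v + w‖ := fun w => by
    have h := norm_add_sq_real v (w : EuclideanSpace ℝ (Fin (m + 1)))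
    rw [hinner w w.2, hv1] at h
    nlinarith [norm_nonneg (v + (w : EuclideanSpace ℝ (Fin (m + 1)))),
      sq_nonneg ‖(w : EuclideanSpace ℝ (Fin (m + 1)))‖]
  set ψ : (ℝ ∙ v)ᗮ → EuclideanSpace ℝ (Fin (m + 1)) := fun w => ‖v + w‖⁻¹ • (v + w) with hψ
  have hlip : LipschitzWith 2 ψ := LipschitzWith.of_dist_le_mul fun a b => by
    rw [dist_eq_norm, dist_eq_norm]
    refine (norm_normalize_sub_le (hnorm a) (hnorm b)).trans_eq ?_
    simp
  have hfin : μHE[m] (ψ '' Metric.closedBall 0 2) < ⊤ := by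
    have h1 : (μHE[m] : Measure (ℝ ∙ v)ᗮ) (Metric.closedBall 0 2) < ⊤ := by
      have := (isCompact_closedBall (0 : (ℝ ∙ v)ᗮ) 2).measure_lt_top
        (μ := (μHE[Module.finrank ℝ (ℝ ∙ v)ᗮ] : Measure (ℝ ∙ v)ᗮ))
      rwa [hfr] at this
    rw [Measure.euclideanHausdorffMeasure_def, Measure.smul_apply, ENNReal.smul_def, smul_eq_mul]
      at h1 ⊢
    have h2 : (μH[m] : Measure (ℝ ∙ v)ᗮ) (Metric.closedBall 0 2) < ⊤ :=
      ENNReal.lt_top_of_mul_ne_top_right h1.ne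
        (by simpa using Measure.addHaarScalarFactor_volume_hausdorffMeasure_ne_zero m)
    refine ENNReal.mul_lt_top ENNReal.coe_lt_top
      ((hlip.hausdorffMeasure_image_le (Nat.cast_nonneg m) _).trans_lt ?_)
    exact ENNReal.mul_lt_top (ENNReal.rpow_lt_top_of_nonneg (Nat.cast_nonneg m) (by simp)) h2
  refine ⟨{y | 1 / 2 < inner ℝ v y} ∩ Metric.sphere 0 1, ?_, ?_⟩
  · refine inter_mem (mem_nhdsWithin_of_mem_nhds ?_) self_mem_nhdsWithin
    refine (isOpen_lt continuous_const (by fun_prop)).mem_nhds ?_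
    rw [mem_ofPred_eq, real_inner_self_eq_norm_sq, hv1]
    norm_num
  · refine (measure_mono ?_).trans_lt hfin
    rintro y ⟨hy, hy1⟩
    have hy1 : ‖y‖ = 1 := by simpa using hy1
    set s := inner ℝ v y with hs
    have hs0 : 1 / 2 < s := hy
    have hw : s⁻¹ • y - v ∈ (ℝ ∙ v)ᗮ := by
      rw [Submodule.mem_orthogonal_singleton_iff_inner_right, inner_sub_right, inner_smul_right,
        real_inner_self_eq_norm_sq, hv1, ← hs, inv_mul_cancel₀ (by linarith)]
      norm_num
    have e : v + (s⁻¹ • y - v) = s⁻¹ • y := by abel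
    have hsn : ‖s⁻¹ • y‖ = s⁻¹ := by
      rw [norm_smul, hy1, Real.norm_eq_abs, abs_of_pos (by positivity), mul_one]
    refine ⟨⟨_, hw⟩, ?_, ?_⟩
    · rw [mem_closedBall_zero_iff]
      have h3 := norm_add_sq_real v (s⁻¹ • y - v)
      rw [e, hinner _ hw, hsn, hv1] at h3
      have h4 : s⁻¹ ≤ 2 := by
        rw [inv_le_comm₀ (by linarith) (by norm_num)]; linarith
      change ‖s⁻¹ • y - v‖ ≤ 2
      have : 0 < s⁻¹ := by positivity
      nlinarith [norm_nonneg (s⁻¹ • y - v)]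
    · simp only [hψ, e, hsn, inv_inv]
      rw [smul_smul, mul_inv_cancel₀ (by linarith), one_smul]

open scoped Pointwise in
theorem euclideanHausdorffMeasure_sphere {R : ℝ} (hR : 0 < R) :
    μHE[n - 1] (Metric.sphere (0 : 𝔼) R)
      = ENNReal.ofReal (R ^ (n - 1)) * μHE[n - 1] (Metric.sphere (0 : 𝔼) 1) := by
  have h : R • Metric.sphere (0 : 𝔼) 1 = Metric.sphere 0 R := by
    rw [smul_sphere' hR.ne', smul_zero, Real.norm_eq_abs, abs_of_pos hR, mul_one]
  rw [← h, Measure.euclideanHausdorffMeasure_smul₀ _ hR.ne', ENNReal.smul_def, smul_eq_mul,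
    ENNReal.ofReal_pow hR.le]
  congr 1
  rw [ENNReal.coe_pow, ← Real.enorm_of_nonneg hR.le]
  rfl

end SphereMeasure

/-! ### The Poisson kernel of a ball and the harmonic barrier. -/

section PoissonKernel

variable {n : ℕ}

local notation "𝔼" => EuclideanSpace ℝ (Fin n)

/-- The (unnormalized) Poisson kernel of the ball of radius `R` around `0`. -/
noncomputable def poissonKernelBall (n : ℕ) (R : ℝ)
    (p : EuclideanSpace ℝ (Fin n) × EuclideanSpace ℝ (Fin n)) : ℝ :=
  (R ^ 2 - ‖p.1‖ ^ 2) / ‖p.1 - p.2‖ ^ n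

theorem contDiffOn_poissonKernelBall (R : ℝ) :
    ContDiffOn ℝ 2 (poissonKernelBall n R) {p | p.1 ≠ p.2} := by
  intro p hp
  have h0 : p.1 - p.2 ≠ 0 := sub_ne_zero.2 hp
  have h1 : ContDiffAt ℝ 2 (fun p : 𝔼 × 𝔼 => ‖p.1 - p.2‖) p :=
    (contDiffAt_fst.sub contDiffAt_snd).norm ℝ h0
  have h2 : ContDiffAt ℝ 2 (fun p : 𝔼 × 𝔼 => R ^ 2 - ‖p.1‖ ^ 2) p :=
    contDiffAt_const.sub ((contDiff_norm_sq ℝ).contDiffAt.comp p contDiffAt_fst)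
  exact (h2.div (h1.pow n) (pow_ne_zero _ (norm_ne_zero_iff.2 h0))).contDiffWithinAt

theorem isOpen_ne_fst_snd : IsOpen {p : 𝔼 × 𝔼 | p.1 ≠ p.2} :=
  isOpen_ne_fun continuous_fst continuous_snd

/-- With z = x - y and ‖y‖ = R one has R² - ‖x‖² = -2⟨y, z⟩ - ‖z‖². The kernel is thus a linear form
times ‖z‖^(-n), minus ‖z‖^(2-n), and both terms are harmonic away from z = 0. -/
theorem hasLap_poissonKernelBall {R : ℝ} {x y : 𝔼} (hy : ‖y‖ = R) (hxy : x ≠ y) :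
    HasLap (fun z => poissonKernelBall n R (z, y)) x 0 := by
  have hz : 0 < ‖x - y‖ ^ 2 := by
    have := norm_pos_iff.2 (sub_ne_zero.2 hxy); positivity
  have d0 : ∀ (a : ℝ) {q : ℝ}, 0 < q → HasDerivAt (fun q : ℝ => q ^ a) (a * q ^ (a - 1)) q :=
    fun a q hq => Real.hasDerivAt_rpow_const (Or.inl hq.ne')
  set ν : ℝ := -(n : ℝ) / 2 with hν
  set Q := ‖x - y‖ ^ 2 with hQ
  have l1 := hasLap_inner_mul_radial (ψ := fun q => q ^ ν) (ψ' := fun q => ν * q ^ (ν - 1))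
    (ψ'' := ν * ((ν - 1) * Q ^ (ν - 1 - 1))) ((-2 : ℝ) • y) (x - y) 0
    ((lt_mem_nhds hz).mono fun q hq => d0 ν hq) ((d0 (ν - 1) hz).const_mul ν)
  have l2 := hasLap_radial (ψ := fun q => q * q ^ ν) (ψ' := fun q => (1 + ν) * q ^ ν)
    (ψ'' := (1 + ν) * (ν * Q ^ (ν - 1))) (x - y)
    ((lt_mem_nhds hz).mono fun q (hq : 0 < q) => by
      refine ((hasDerivAt_id q).fun_mul (d0 ν hq)).congr_deriv ?_
      have : q ^ ν = q ^ (ν - 1) * q := by rw [← Real.rpow_add_one hq.ne']; ring_nf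
      rw [this]
      simp only [id]
      ring) ((d0 ν hz).const_mul (1 + ν))
  have l := (l1.add (l2.const_mul (-1))).comp_sub_const
  have e1 : Q ^ (ν - 1) = Q ^ (ν - 1 - 1) * Q := by rw [← Real.rpow_add_one hz.ne']; ring_nf
  have e2 : Q ^ ν = Q ^ (ν - 1) * Q := by rw [← Real.rpow_add_one hz.ne']; ring_nf
  convert l using 1
  · funext z
    have e3 : (‖z - y‖ ^ 2) ^ ν = (‖z - y‖ ^ n)⁻¹ := by
      rw [hν, neg_div, Real.rpow_neg (by positivity), ← Real.rpow_natCast, ← Real.rpow_mul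
        (norm_nonneg _), Nat.cast_ofNat, mul_div_cancel₀ _ (by norm_num : (2 : ℝ) ≠ 0),
        Real.rpow_natCast]
    have e4 : ‖z‖ ^ 2 = R ^ 2 + 2 * inner ℝ y (z - y) + ‖z - y‖ ^ 2 := by
      have := norm_add_sq_real y (z - y)
      rwa [add_sub_cancel, hy] at this
    simp only [poissonKernelBall, e3]
    rw [e4, inner_smul_left]
    simp only [conj_trivial]
    ring
  · rw [e2, e1, hν]
    ring

theorem poissonKernelBall_nonneg {R : ℝ} {x : 𝔼} (hx : ‖x‖ < R) (y : 𝔼) :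
    0 ≤ poissonKernelBall n R (x, y) := by
  refine div_nonneg ?_ (by positivity)
  simp only [sub_nonneg]
  exact pow_le_pow_left₀ (norm_nonneg _) hx.le 2

theorem ne_of_norm_lt_of_norm_eq {R : ℝ} {x y : 𝔼} (hx : ‖x‖ < R) (hy : ‖y‖ = R) : x ≠ y := by
  rintro rfl; exact hx.ne hy

variable {σ : Measure (EuclideanSpace ℝ (Fin n))} [IsFiniteMeasure σ] {R : ℝ}
  {Y : Set (EuclideanSpace ℝ (Fin n))}

theorem continuousAt_integral_poissonKernelBall (hY : IsCompact Y) (hYm : ∀ᵐ y ∂σ, y ∈ Y) {x : 𝔼}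
    (hx : x ∉ Y) : ContinuousAt (fun z => ∫ y, poissonKernelBall n R (z, y) ∂σ) x := by
  have := continuousAt_integral_kernel (c := fun _ => 1) hYm hY isOpen_ne_fst_snd
    (contDiffOn_poissonKernelBall R).continuousOn (integrable_const 1)
    (x := x) (fun y hy => ne_of_mem_of_not_mem hy hx |>.symm)
  simpa using this

theorem integrable_poissonKernelBall (hY : IsCompact Y) (hYm : ∀ᵐ y ∂σ, y ∈ Y) {x : 𝔼}
    (hx : x ∉ Y) : Integrable (fun y => poissonKernelBall n R (x, y)) σ := by
  have := integrable_kernel (c := fun _ => 1) hYm hY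
    (contDiffOn_poissonKernelBall R).continuousOn (integrable_const 1)
    (x := x) (fun y hy => ne_of_mem_of_not_mem hy hx |>.symm)
  simpa using this

theorem hasLap_integral_poissonKernelBall (hY : IsCompact Y) (hYm : ∀ᵐ y ∂σ, y ∈ Y)
    (hYR : ∀ y ∈ Y, ‖y‖ = R) {x : 𝔼} (hx : x ∉ Y) :
    HasLap (fun z => ∫ y, poissonKernelBall n R (z, y) ∂σ) x 0 := by
  have := hasLap_integral_kernel (c := fun _ => 1) hYm hY isOpen_ne_fst_snd
    (contDiffOn_poissonKernelBall R) (integrable_const 1)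
    (x := x) (ℓ := fun _ => 0) (fun y hy => ne_of_mem_of_not_mem hy hx |>.symm)
    (fun y hy => hasLap_poissonKernelBall (hYR y hy) (by rintro rfl; exact hx hy))
  simpa using this

theorem not_mem_of_norm_lt (hYR : ∀ y ∈ Y, ‖y‖ = R) {x : 𝔼} (hx : ‖x‖ < R) : x ∉ Y :=
  fun h => hx.ne (hYR x h)

/-- The Poisson integral of the constant function is constant. -/
theorem setIntegral_poissonKernelBall_sphere (hn : 1 ≤ n) (hR : 0 < R) {x : 𝔼} (hx : ‖x‖ < R) :
    ∫ y in Metric.sphere 0 R, poissonKernelBall n R (x, y) ∂μHE[n - 1]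
      = R * (μHE[n - 1] (Metric.sphere (0 : 𝔼) 1)).toReal := by
  have hS := isCompact_sphere (0 : 𝔼) R
  have hfin : μHE[n - 1] (Metric.sphere (0 : 𝔼) R) < ⊤ := by
    rw [euclideanHausdorffMeasure_sphere hR]
    exact ENNReal.mul_lt_top ENNReal.ofReal_lt_top (euclideanHausdorffMeasure_sphere_lt_top hn)
  set σ : Measure 𝔼 := μHE[n - 1].restrict (Metric.sphere 0 R) with hσ
  have : IsFiniteMeasure σ := ⟨by simpa [hσ] using hfin⟩
  have hae : ∀ᵐ y ∂σ, y ∈ Metric.sphere (0 : 𝔼) R :=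
    ae_restrict_mem hS.measurableSet
  have hSR : ∀ y ∈ Metric.sphere (0 : 𝔼) R, ‖y‖ = R := fun y hy => by simpa using hy
  set F : 𝔼 → ℝ := fun z => ∫ y, poissonKernelBall n R (z, y) ∂σ with hF
  -- A reflection exchanging z and w preserves the sphere and its measure, so F is radial. As F is
  -- harmonic and constant on the boundary of the ball of radius ‖x‖, the maximum principle for F
  -- and -F gives F x = F 0, which is explicit.
  have hrot : ∀ z w : 𝔼, ‖z‖ = ‖w‖ → F z = F w := by
    intro z w hzw
    set L := (ℝ ∙ (z - w))ᗮ.reflection with hL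
    have hLz : L z = w := Submodule.reflection_sub hzw
    have hmp := L.toIsometryEquiv.measurePreserving_euclideanHausdorffMeasure (n - 1)
    have hme : MeasurableEmbedding L.toIsometryEquiv :=
      L.toIsometryEquiv.toHomeomorph.measurableEmbedding
    have h1 := hmp.setIntegral_preimage_emb hme (fun y => poissonKernelBall n R (w, y))
      (Metric.sphere 0 R)
    have h2 : (L.toIsometryEquiv : 𝔼 → 𝔼) ⁻¹' Metric.sphere 0 R = Metric.sphere 0 R := by
      ext y; simp
    rw [h2] at h1
    rw [hF]
    simp only [hσ]
    rw [← h1]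
    congr 1
    funext y
    have h3 : ‖w - L y‖ = ‖z - y‖ := by rw [← hLz, ← map_sub, L.norm_map]
    simp [poissonKernelBall, h3, hzw]
  have hF0 : F 0 = R * (μHE[n - 1] (Metric.sphere (0 : 𝔼) 1)).toReal := by
    have h1 : F 0 = ∫ y, R ^ 2 / R ^ n ∂σ := by
      refine integral_congr_ae (hae.mono fun y hy => ?_)
      simp [poissonKernelBall, hSR y hy]
    rw [h1, integral_const, Measure.real, hσ, Measure.restrict_apply_univ,
      euclideanHausdorffMeasure_sphere hR, ENNReal.toReal_mul,
      ENNReal.toReal_ofReal (by positivity), smul_eq_mul]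
    obtain ⟨m, rfl⟩ : ∃ m, n = m + 1 := ⟨n - 1, by omega⟩
    simp only [Nat.add_sub_cancel]
    field_simp
    ring
  change F x = _
  rw [← hF0]
  rcases eq_or_ne x 0 with rfl | hx0
  · rfl
  have hxpos := norm_pos_iff.2 hx0
  have hK := isCompact_closedBall (0 : 𝔼) ‖x‖
  have hmemS : ∀ z ∈ Metric.closedBall (0 : 𝔼) ‖x‖, z ∉ Metric.sphere (0 : 𝔼) R := fun z hz =>
    not_mem_of_norm_lt hSR ((mem_closedBall_zero_iff.1 hz).trans_lt hx)
  have hcont : ContinuousOn F (Metric.closedBall 0 ‖x‖) := fun z hz =>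
    (continuousAt_integral_poissonKernelBall hS hae (hmemS z hz)).continuousWithinAt
  have hlap : ∀ z ∈ interior (Metric.closedBall (0 : 𝔼) ‖x‖), HasLap F z 0 := fun z hz =>
    hasLap_integral_poissonKernelBall hS hae hSR (hmemS z (interior_subset hz))
  have hbd : ∀ z ∈ Metric.closedBall (0 : 𝔼) ‖x‖ \ interior (Metric.closedBall (0 : 𝔼) ‖x‖),
      F z = F x := by
    intro z hz
    refine hrot z x ?_
    rw [interior_closedBall _ hxpos.ne'] at hz
    simpa using le_antisymm (by simpa using hz.1) (not_lt.1 (by simpa using hz.2))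
  have h0 : (0 : 𝔼) ∈ Metric.closedBall (0 : 𝔼) ‖x‖ := by simp
  refine le_antisymm ?_ ?_
  · have := le_of_hasLap_nonneg hn hK (Φ := fun z => -1 * F z) (B := -1 * F x)
      (continuousOn_const.mul hcont) (fun z hz => ⟨0, le_rfl, by simpa using (hlap z hz).const_mul (-1)⟩)
      (fun z hz => by rw [hbd z hz]) 0 h0
    linarith
  · exact le_of_hasLap_nonneg hn hK hcont (fun z hz => ⟨0, le_rfl, hlap z hz⟩)
      (fun z hz => (hbd z hz).le) 0 h0

/-- Normalizing constant: a positive upper bound for the area of the unit sphere. -/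
noncomputable def sphereArea (n : ℕ) : ℝ :=
  (μHE[n - 1] (Metric.sphere (0 : EuclideanSpace ℝ (Fin n)) 1)).toReal + 1

theorem sphereArea_pos (n : ℕ) : 0 < sphereArea n := by
  unfold sphereArea; positivity

/-- A harmonic function between `0` and `1` on a ball which vanishes on the boundary away from `E`
and is bounded below inside by a multiple of the area of `E`. -/
theorem exists_harmonic_barrier (hn : 1 ≤ n) (hR : 0 < R) {τ ν : ℝ} (hτ1 : τ < 1)
    (hν : 0 < ν) {E : Set 𝔼} (hE : IsClosed E) (hES : E ⊆ Metric.sphere 0 R)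
    (hEν : ENNReal.ofReal (ν * R ^ (n - 1)) ≤ μHE[n - 1] E) :
    ∃ b : 𝔼 → ℝ, ContinuousOn b (Metric.ball 0 R) ∧ (∀ x ∈ Metric.ball (0 : 𝔼) R, HasLap b x 0) ∧
      (∀ x ∈ Metric.ball (0 : 𝔼) R, 0 ≤ b x ∧ b x ≤ 1) ∧
      (∀ z ∈ Metric.sphere (0 : 𝔼) R \ E, Tendsto b (𝓝 z) (𝓝 0)) ∧
      ∀ x ∈ Metric.ball (0 : 𝔼) (τ * R), (1 - τ ^ 2) / (1 + τ) ^ n * ν / sphereArea n ≤ b x := by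
  have hS := isCompact_sphere (0 : 𝔼) R
  have hEc : IsCompact E := hS.of_isClosed_subset hE hES
  have hfin : μHE[n - 1] (Metric.sphere (0 : 𝔼) R) < ⊤ := by
    rw [euclideanHausdorffMeasure_sphere hR]
    exact ENNReal.mul_lt_top ENNReal.ofReal_lt_top (euclideanHausdorffMeasure_sphere_lt_top hn)
  have hEfin : μHE[n - 1] E < ⊤ := (measure_mono hES).trans_lt hfin
  set σ : Measure 𝔼 := μHE[n - 1].restrict E with hσ
  have : IsFiniteMeasure σ := ⟨by simpa [hσ] using hEfin⟩
  have hσS : IsFiniteMeasure ((μHE[n - 1] : Measure 𝔼).restrict (Metric.sphere 0 R)) :=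
    ⟨by simpa using hfin⟩
  have hae : ∀ᵐ y ∂σ, y ∈ E := ae_restrict_mem hE.measurableSet
  have hER : ∀ y ∈ E, ‖y‖ = R := fun y hy => by simpa using hES hy
  have hSR : ∀ y ∈ Metric.sphere (0 : 𝔼) R, ‖y‖ = R := fun y hy => by simpa using hy
  set F : 𝔼 → ℝ := fun z => ∫ y, poissonKernelBall n R (z, y) ∂σ with hF
  -- Λ exceeds the Poisson integral of 1. The `+ 1` in `sphereArea` makes Λ positive without a lower
  -- bound for the area of the sphere, at the cost of a smaller gain.
  set Λ := sphereArea n * R with hΛ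
  have hΛ0 : 0 < Λ := mul_pos (sphereArea_pos n) hR
  have hnot : ∀ x ∈ Metric.ball (0 : 𝔼) R, x ∉ E := fun x hx =>
    not_mem_of_norm_lt hER (by simpa using hx)
  refine ⟨fun z => Λ⁻¹ * F z, ?_, ?_, ?_, ?_, ?_⟩
  · exact fun x hx => ((continuousAt_integral_poissonKernelBall hEc hae
      (hnot x hx)).const_smul Λ⁻¹).continuousWithinAt
  · intro x hx
    simpa using (hasLap_integral_poissonKernelBall hEc hae hER (hnot x hx)).const_mul Λ⁻¹
  · intro x hx
    have hxR : ‖x‖ < R := by simpa using hx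
    have h0 : 0 ≤ F x := integral_nonneg fun y => poissonKernelBall_nonneg hxR y
    refine ⟨mul_nonneg (inv_nonneg.2 hΛ0.le) h0, ?_⟩
    rw [inv_mul_le_iff₀ hΛ0, mul_one]
    calc F x ≤ ∫ y in Metric.sphere 0 R, poissonKernelBall n R (x, y) ∂μHE[n - 1] :=
          setIntegral_mono_set (integrable_poissonKernelBall hS (ae_restrict_mem hS.measurableSet)
            (not_mem_of_norm_lt hSR hxR))
            (Eventually.of_forall fun y => poissonKernelBall_nonneg hxR y)
            (LE.le.eventuallyLE hES)
      _ = R * (μHE[n - 1] (Metric.sphere (0 : 𝔼) 1)).toReal :=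
          setIntegral_poissonKernelBall_sphere hn hR hxR
      _ ≤ Λ := by
          rw [hΛ, sphereArea]; nlinarith
  · rintro z ⟨hz, hzE⟩
    have h1 := ((continuousAt_integral_poissonKernelBall (R := R) hEc hae hzE).const_smul Λ⁻¹).tendsto
    -- On the sphere the numerator of the kernel vanishes; off the closed set E the integral is
    -- continuous, so this value is the limit.
    have h2 : F z = 0 := by
      simp [hF, poissonKernelBall, hSR z hz]
    have h3 : Λ⁻¹ • F z = 0 := by rw [h2, smul_zero]
    rw [← h3]
    exact h1
  · intro x hx
    have hxτ : ‖x‖ < τ * R := by simpa using hx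
    have hτ0 : 0 < τ := by
      by_contra h
      nlinarith [norm_nonneg x]
    have hxR : ‖x‖ < R := hxτ.trans (by nlinarith)
    set κ := (1 - τ ^ 2) * R ^ 2 / ((1 + τ) * R) ^ n with hκ
    have hκ0 : 0 ≤ κ := by
      have : 0 ≤ 1 - τ ^ 2 := by nlinarith
      positivity
    have hlow : ∀ y ∈ E, κ ≤ poissonKernelBall n R (x, y) := by
      intro y hy
      have h1 : ‖x - y‖ ≤ (1 + τ) * R := by
        have := norm_sub_le x y
        rw [hER y hy] at this
        linarith
      have h2 : 0 < ‖x - y‖ := norm_pos_iff.2 (sub_ne_zero.2 (ne_of_norm_lt_of_norm_eq hxR (hER y hy)))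
      have h3 : (1 - τ ^ 2) * R ^ 2 ≤ R ^ 2 - ‖x‖ ^ 2 := by
        have := pow_le_pow_left₀ (norm_nonneg x) hxτ.le 2
        nlinarith
      have h4 : 0 ≤ R ^ 2 - ‖x‖ ^ 2 := by
        have := pow_le_pow_left₀ (norm_nonneg x) hxR.le 2
        linarith
      exact div_le_div₀ h4 h3 (by positivity) (pow_le_pow_left₀ h2.le h1 n)
    have h5 : κ * (ν * R ^ (n - 1)) ≤ F x := by
      calc κ * (ν * R ^ (n - 1)) ≤ κ * (μHE[n - 1] E).toReal := by
            refine mul_le_mul_of_nonneg_left ?_ hκ0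
            exact (ENNReal.ofReal_le_iff_le_toReal hEfin.ne).1 hEν
        _ = ∫ y, κ ∂σ := by
            rw [integral_const, Measure.real, hσ, Measure.restrict_apply_univ, smul_eq_mul, mul_comm]
        _ ≤ F x := integral_mono_ae (integrable_const _)
            (integrable_poissonKernelBall hEc hae (not_mem_of_norm_lt hER hxR))
            (hae.mono hlow)
    have h6 : (1 - τ ^ 2) / (1 + τ) ^ n * ν / sphereArea n = Λ⁻¹ * (κ * (ν * R ^ (n - 1))) := by
      have := sphereArea_pos n
      rw [hΛ, hκ, mul_pow]
      obtain ⟨m, rfl⟩ : ∃ m, n = m + 1 := ⟨n - 1, by omega⟩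
      simp only [Nat.add_sub_cancel]
      field_simp
      ring
    rw [h6]
    exact mul_le_mul_of_nonneg_left h5 (inv_nonneg.2 hΛ0.le)

end PoissonKernel

/-! ### Regularized fundamental solutions and L^p bounds for potentials. -/

section NewtonianPotential

variable {n : ℕ}

local notation "𝔼" => EuclideanSpace ℝ (Fin n)

/-- A profile whose derivative is `(q + ε²) ^ (-n/2)`; composed with the squared norm it is a
regularized fundamental solution. -/
theorem exists_radial_profile (hn : 2 ≤ n) {a : ℝ} (ha : (n : ℝ) - 2 < a) :
    ∃ C > 0, ∀ r ε : ℝ, 0 < ε → ε ≤ r → ∃ ψ : ℝ → ℝ,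
      (∀ q, 0 ≤ q → ContDiffAt ℝ 2 ψ q) ∧
      (∀ q, -ε ^ 2 < q → HasDerivAt ψ ((q + ε ^ 2) ^ (-(n : ℝ) / 2)) q) ∧
      ∀ s, 0 < s → s ≤ 2 * r → |ψ (s ^ 2)| ≤ C * r ^ (a - n + 2) * s ^ (-a) := by
  rcases hn.eq_or_lt with rfl | hn
  · have ha0 : 0 < a := by simpa using ha
    refine ⟨2 / a * 5 ^ (a / 2), by positivity, fun r ε hε hεr =>
      ⟨fun q => Real.log ((q + ε ^ 2) / (5 * r ^ 2)), fun q hq => ?_, fun q hq => ?_,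
        fun s hs hsr => ?_⟩⟩
    · have hr : 0 < r := hε.trans_le hεr
      refine ContDiffAt.log (by fun_prop) ?_
      positivity
    · have hr : 0 < r := hε.trans_le hεr
      have hq' : 0 < q + ε ^ 2 := by linarith
      have h1 : HasDerivAt (fun q : ℝ => (q + ε ^ 2) / (5 * r ^ 2)) (1 / (5 * r ^ 2)) q :=
        ((hasDerivAt_id q).add_const _).div_const _
      refine (h1.log (by positivity)).congr_deriv ?_
      rw [show -((2 : ℕ) : ℝ) / 2 = -1 by norm_num, Real.rpow_neg_one]
      field_simp
    · have hr : 0 < r := hε.trans_le hεr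
      have hpos : 0 < s ^ 2 + ε ^ 2 := by positivity
      set w := (s ^ 2 + ε ^ 2) / (5 * r ^ 2) with hw
      have hw0 : 0 < w := by positivity
      have hw1 : w ≤ 1 := by
        rw [hw, div_le_one (by positivity)]
        nlinarith
      have h1 : |Real.log w| = Real.log w⁻¹ := by
        rw [abs_of_nonpos (Real.log_nonpos hw0.le hw1), Real.log_inv]
      rw [h1]
      have hwi : w⁻¹ ≤ 5 * (r ^ 2 * (s ^ 2)⁻¹) := by
        rw [hw, inv_div, div_eq_mul_inv, mul_assoc]
        gcongr
        nlinarith [sq_nonneg ε]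
      calc Real.log w⁻¹ ≤ w⁻¹ ^ (a / 2) / (a / 2) := Real.log_le_rpow_div (by positivity) (by positivity)
        _ ≤ (5 * (r ^ 2 * (s ^ 2)⁻¹)) ^ (a / 2) / (a / 2) := by gcongr
        _ = 2 / a * 5 ^ (a / 2) * r ^ a * s ^ (-a) := by
          have h3 : ∀ t : ℝ, 0 < t → (t ^ 2) ^ (a / 2) = t ^ a := fun t ht => by
            rw [← Real.rpow_natCast, ← Real.rpow_mul ht.le]
            congr 1
            push_cast
            ring
          rw [Real.mul_rpow (by norm_num) (by positivity), Real.mul_rpow (by positivity)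
            (by positivity), Real.inv_rpow (by positivity), h3 r hr, h3 s hs, Real.rpow_neg hs.le]
          field_simp
        _ = _ := by norm_num
  · have hn2 : (2 : ℝ) < n := by exact_mod_cast hn
    -- For n ≥ 3 the profile is of size s^(2-n) = s^(a-n+2) s^(-a); the first exponent is positive,
    -- so s ≤ 2r turns that factor into a power of r.
    set m : ℝ := ((n : ℝ) - 2) / 2 with hm
    have hm0 : 0 < m := by rw [hm]; linarith
    refine ⟨m⁻¹ * 2 ^ (a - n + 2), by positivity, fun r ε hε hεr =>
      ⟨fun q => -m⁻¹ * (q + ε ^ 2) ^ (-m), fun q hq => ?_, fun q hq => ?_, fun s hs hsr => ?_⟩⟩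
    · refine contDiffAt_const.mul (ContDiffAt.rpow_const_of_ne (by fun_prop) ?_)
      positivity
    · have hq' : 0 < q + ε ^ 2 := by linarith
      have h1 : HasDerivAt (fun q : ℝ => q + ε ^ 2) 1 q := (hasDerivAt_id q).add_const _
      refine ((h1.rpow_const (p := -m) (Or.inl hq'.ne')).const_mul (-m⁻¹)).congr_deriv ?_
      rw [show -m - 1 = -(n : ℝ) / 2 by rw [hm]; ring]
      field_simp
    · have hr : 0 < r := hε.trans_le hεr
      have hpos : 0 < s ^ 2 + ε ^ 2 := by positivity
      rw [abs_mul, abs_neg, abs_of_pos (by positivity : 0 < m⁻¹),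
        abs_of_pos (by positivity : 0 < (s ^ 2 + ε ^ 2) ^ (-m))]
      have h1 : (s ^ 2 + ε ^ 2) ^ (-m) ≤ (s ^ 2) ^ (-m) :=
        Real.rpow_le_rpow_of_nonpos (by positivity) (by nlinarith [sq_nonneg ε]) (by linarith)
      have h2 : (s ^ 2) ^ (-m) = s ^ (a - n + 2) * s ^ (-a) := by
        rw [← Real.rpow_natCast, ← Real.rpow_mul hs.le, ← Real.rpow_add hs, hm]
        congr 1
        push_cast
        ring
      have h3 : s ^ (a - n + 2) ≤ 2 ^ (a - n + 2) * r ^ (a - n + 2) := by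
        rw [← Real.mul_rpow (by norm_num) hr.le]
        exact Real.rpow_le_rpow hs.le hsr (by linarith)
      calc m⁻¹ * (s ^ 2 + ε ^ 2) ^ (-m) ≤ m⁻¹ * (s ^ (a - n + 2) * s ^ (-a)) := by
            rw [← h2]; gcongr
        _ ≤ m⁻¹ * ((2 ^ (a - n + 2) * r ^ (a - n + 2)) * s ^ (-a)) := by gcongr
        _ = _ := by ring

/-- A regularized fundamental solution: its Laplacian is nonnegative and dominates `ε ^ (-n)` on the
ball of radius `ε`, with bounds independent of `ε`. -/
theorem exists_regularized_fundamental_solution (hn : 2 ≤ n) {a : ℝ} (ha : (n : ℝ) - 2 < a) :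
    ∃ C > 0, ∀ r ε : ℝ, 0 < ε → ε ≤ r → ∃ N ℓ : 𝔼 → ℝ, ContDiff ℝ 2 N ∧ Continuous ℓ ∧
      (∀ z, HasLap N z (ℓ z)) ∧ (∀ z, 0 ≤ ℓ z) ∧ (∀ z, ‖z‖ ≤ ε → (ε ^ n)⁻¹ ≤ C * ℓ z) ∧
      ∀ z, z ≠ 0 → ‖z‖ ≤ 2 * r → |N z| ≤ C * r ^ (a - n + 2) * ‖z‖ ^ (-a) := by
  obtain ⟨C, hC0, hC⟩ := exists_radial_profile hn ha
  have hn0 : (0 : ℝ) < n := by exact_mod_cast (by omega : 0 < n)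
  set c : ℝ := (2 * (n : ℝ))⁻¹ * 2 ^ ((n : ℝ) / 2 + 1) with hc
  have hc0 : 0 < c := by positivity
  refine ⟨max C c, lt_max_of_lt_left hC0, fun r ε hε hεr => ?_⟩
  obtain ⟨ψ, hψ2, hψ', hψb⟩ := hC r ε hε hεr
  have hpos : ∀ z : 𝔼, 0 < ‖z‖ ^ 2 + ε ^ 2 := fun z => by positivity
  -- With Q = ‖z‖² + ε², the radial formula 4‖z‖²ψ'' + 2nψ' equals 2n Q^(-n/2-1) (Q - ‖z‖²), and Q -
  -- ‖z‖² = ε². If ‖z‖ ≤ ε then Q ≤ 2ε², and c is the constant for Q = 2ε².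
  refine ⟨fun z => ψ (‖z‖ ^ 2), fun z => 2 * n * ε ^ 2 * (‖z‖ ^ 2 + ε ^ 2) ^ (-(n : ℝ) / 2 - 1),
    ?_, ?_, ?_, ?_, ?_, ?_⟩
  · exact contDiff_iff_contDiffAt.2 fun z => (hψ2 _ (sq_nonneg _)).comp z
      (contDiff_norm_sq ℝ).contDiffAt
  · refine continuous_const.mul (Continuous.rpow_const (by fun_prop) fun z => Or.inl (hpos z).ne')
  · intro z
    have hQ := hpos z
    have d : HasDerivAt (fun q : ℝ => (q + ε ^ 2) ^ (-(n : ℝ) / 2))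
        (-(n : ℝ) / 2 * (‖z‖ ^ 2 + ε ^ 2) ^ (-(n : ℝ) / 2 - 1)) (‖z‖ ^ 2) := by
      have h1 : HasDerivAt (fun q : ℝ => q + ε ^ 2) 1 (‖z‖ ^ 2) := (hasDerivAt_id _).add_const _
      exact (h1.rpow_const (p := -(n : ℝ) / 2) (Or.inl hQ.ne')).congr_deriv (by ring)
    have hl := hasLap_radial z ((lt_mem_nhds (by nlinarith [sq_nonneg ‖z‖, hε] :
      -ε ^ 2 < ‖z‖ ^ 2)).mono fun q hq => hψ' q hq) d
    convert hl using 1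
    have e : (‖z‖ ^ 2 + ε ^ 2) ^ (-(n : ℝ) / 2)
        = (‖z‖ ^ 2 + ε ^ 2) ^ (-(n : ℝ) / 2 - 1) * (‖z‖ ^ 2 + ε ^ 2) := by
      rw [← Real.rpow_add_one hQ.ne']; ring_nf
    rw [e]
    ring
  · intro z
    have hQ := hpos z
    positivity
  · intro z hz
    have hQ := hpos z
    have h1 : (2 * ε ^ 2) ^ (-(n : ℝ) / 2 - 1) ≤ (‖z‖ ^ 2 + ε ^ 2) ^ (-(n : ℝ) / 2 - 1) := by
      refine Real.rpow_le_rpow_of_nonpos hQ ?_ (by linarith)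
      have := pow_le_pow_left₀ (norm_nonneg z) hz 2
      linarith
    have h2 : (ε ^ n)⁻¹ = c * (2 * n * ε ^ 2 * (2 * ε ^ 2) ^ (-(n : ℝ) / 2 - 1)) := by
      have e1 : (2 : ℝ) ^ (-(n : ℝ) / 2 - 1) = (2 ^ ((n : ℝ) / 2 + 1))⁻¹ := by
        rw [← Real.rpow_neg (by norm_num)]; ring_nf
      have e2 : (ε ^ 2) ^ (-(n : ℝ) / 2 - 1) = (ε ^ n)⁻¹ * (ε ^ 2)⁻¹ := by
        rw [← Real.rpow_natCast ε 2, ← Real.rpow_mul hε.le, ← Real.rpow_natCast,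
          ← Real.rpow_neg hε.le, ← Real.rpow_neg hε.le, ← Real.rpow_add hε]
        congr 1
        push_cast
        ring
      rw [Real.mul_rpow (by norm_num) (by positivity), e1, e2, hc]
      field_simp
    rw [h2]
    have : c ≤ max C c := le_max_right _ _
    dsimp only
    gcongr
  · intro z hz hzr
    refine (hψb ‖z‖ (norm_pos_iff.2 hz) hzr).trans ?_
    have hr : 0 < r := hε.trans_le hεr
    have : C ≤ max C c := le_max_left _ _
    gcongr

theorem setIntegral_norm_rpow_ball {b ρ : ℝ} (hρ : 0 < ρ) :
    ∫ z in Metric.ball (0 : 𝔼) ρ, ‖z‖ ^ (-b)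
      = ρ ^ ((n : ℝ) - b) * ∫ z in Metric.ball (0 : 𝔼) 1, ‖z‖ ^ (-b) := by
  have h := Measure.setIntegral_comp_smul_of_pos (volume : Measure 𝔼) (fun z => ‖z‖ ^ (-b))
    (Metric.ball 0 1) hρ
  rw [smul_unitBall_of_pos hρ] at h
  have h1 : ∀ z : 𝔼, ‖ρ • z‖ ^ (-b) = ρ ^ (-b) * ‖z‖ ^ (-b) := fun z => by
    rw [norm_smul, Real.norm_eq_abs, abs_of_pos hρ, Real.mul_rpow hρ.le (norm_nonneg z)]
  simp_rw [h1] at h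
  rw [integral_const_mul, finrank_euclideanSpace_fin, smul_eq_mul] at h
  have h2 : ρ ^ ((n : ℝ) - b) = ρ ^ n * ρ ^ (-b) := by
    rw [sub_eq_add_neg, Real.rpow_add hρ, Real.rpow_natCast]
  rw [h2, mul_assoc, h]
  have := (pow_pos hρ n).ne'
  field_simp

theorem integrableOn_norm_rpow_ball (hn : 1 ≤ n) {b : ℝ} (hb : b < n) (ρ : ℝ) :
    IntegrableOn (fun z : 𝔼 => ‖z‖ ^ (-b)) (Metric.ball 0 ρ) := by
  have : Nonempty (Fin n) := ⟨⟨0, hn⟩⟩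
  rcases le_or_gt ρ 0 with hρ | hρ
  · simp [Metric.ball_eq_empty.2 hρ]
  rw [integrableOn_fun_norm_addHaar volume (f := fun t : ℝ => t ^ (-b)), finrank_euclideanSpace_fin]
  have h := (intervalIntegral.integrableOn_Ioo_rpow_iff hρ (s := (n : ℝ) - 1 - b)).2 (by linarith)
  refine h.congr_fun (fun t ht => ?_) measurableSet_Ioo
  have ht0 : 0 < t := ht.1
  simp only [smul_eq_mul]
  rw [← Real.rpow_natCast, ← Real.rpow_add ht0, Nat.cast_sub hn]
  congr 1
  push_cast
  ring

/-- Translation and scaling reduce the q-th power of the norm to (2r)^(n - aq) times an integral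
over the unit ball, finite because aq < n. -/
theorem exists_eLpNorm_norm_rpow_ball_le (hn : 1 ≤ n) {q : ℝ≥0∞} (hq1 : 1 ≤ q) (hq : q ≠ ⊤) {a : ℝ}
    (ha : a * q.toReal < n) : ∃ C > 0, ∀ (r : ℝ) (x : 𝔼), 0 < r →
      eLpNorm (fun y => ‖x - y‖ ^ (-a)) q (volume.restrict (Metric.ball x (2 * r)))
        ≤ ENNReal.ofReal (C * r ^ ((n : ℝ) * (q⁻¹).toReal - a)) := by
  have hq0 : 0 < q.toReal := ENNReal.toReal_pos (by positivity) hq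
  set b := a * q.toReal with hb
  set J := ∫ z in Metric.ball (0 : 𝔼) 1, ‖z‖ ^ (-b) with hJ
  have hJ0 : 0 ≤ J := integral_nonneg fun z => by positivity
  set e : ℝ := (n : ℝ) * (q⁻¹).toReal - a with he
  have hqe : ((n : ℝ) - b) * (1 / q.toReal) = e := by
    rw [he, hb, ENNReal.toReal_inv]
    field_simp
  refine ⟨2 ^ e * J ^ (1 / q.toReal) + 1, by positivity, fun r x hr => ?_⟩
  rw [eLpNorm_eq_lintegral_rpow_enorm_toReal (by positivity) hq]
  have h1 : ∀ y : 𝔼, ‖‖x - y‖ ^ (-a)‖ₑ ^ q.toReal = ENNReal.ofReal (‖x - y‖ ^ (-b)) := by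
    intro y
    rw [Real.enorm_of_nonneg (by positivity), ENNReal.ofReal_rpow_of_nonneg (by positivity) hq0.le,
      ← Real.rpow_mul (norm_nonneg _), hb]
    congr 2
    ring
  simp_rw [h1]
  have hmp : MeasurePreserving (fun y : 𝔼 => x - y) volume volume :=
    Measure.measurePreserving_sub_left volume x
  have h2 := hmp.setLIntegral_comp_preimage (s := Metric.ball 0 (2 * r)) measurableSet_ball
    (f := fun z => ENNReal.ofReal (‖z‖ ^ (-b))) (by fun_prop)
  have h3 : (fun y : 𝔼 => x - y) ⁻¹' Metric.ball 0 (2 * r) = Metric.ball x (2 * r) := by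
    ext y
    simp [dist_eq_norm, norm_sub_rev]
  rw [h3] at h2
  rw [h2, ← ofReal_integral_eq_lintegral_ofReal (integrableOn_norm_rpow_ball hn ha _)
    (Eventually.of_forall fun z => by positivity), setIntegral_norm_rpow_ball (by positivity),
    ENNReal.ofReal_rpow_of_nonneg (by positivity) (by positivity)]
  refine ENNReal.ofReal_le_ofReal ?_
  rw [Real.mul_rpow (by positivity) hJ0, ← Real.rpow_mul (by positivity), hqe,
    Real.mul_rpow (by norm_num) hr.le]
  have : 0 < r ^ e := by positivity
  nlinarith

theorem conjExponent_facts (hn : 2 ≤ n) {p : ℝ≥0∞} (hp : (n : ℝ≥0∞) / 2 < p) :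
    1 < p ∧ (n : ℝ) * (p⁻¹).toReal < 2 := by
  have h1 : (1 : ℝ≥0∞) ≤ (n : ℝ≥0∞) / 2 := by
    rw [ENNReal.le_div_iff_mul_le (by simp) (by simp), one_mul]
    exact_mod_cast hn
  have hp1 := h1.trans_lt hp
  refine ⟨hp1, ?_⟩
  rcases eq_or_ne p ⊤ with rfl | hpt
  · simp
  have hp0 : 0 < p.toReal := ENNReal.toReal_pos (by positivity) hpt
  have h2 := (ENNReal.toReal_lt_toReal (ENNReal.div_ne_top (by simp) (by simp)) hpt).2 hp
  rw [ENNReal.toReal_div] at h2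
  simp only [ENNReal.toReal_natCast, ENNReal.toReal_ofNat] at h2
  rw [ENNReal.toReal_inv, ← div_eq_mul_inv, div_lt_iff₀ hp0]
  linarith

/-- Bounds on the size and support of a mollifier at scale `ε`. -/
structure IsMollifierAt (n : ℕ) (ε : ℝ) (φ : EuclideanSpace ℝ (Fin n) → ℝ) : Prop where
  continuous : Continuous φ
  abs_le : ∀ z, |φ z| ≤
    2 ^ n * (volume.real (Metric.ball (0 : EuclideanSpace ℝ (Fin n)) 1))⁻¹ * (ε ^ n)⁻¹
  eq_zero : ∀ z, ε < ‖z‖ → φ z = 0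

/-- The Newtonian potential of `|f|`, regularized so that its Laplacian dominates a given
mollification of `f`. -/
theorem exists_potential (hn : 2 ≤ n) {p : ℝ≥0∞} (hp : (n : ℝ≥0∞) / 2 < p) :
    ∃ A > 0, ∀ (r : ℝ) (D : Set 𝔼) (f : 𝔼 → ℝ), 0 < r → D ⊆ Metric.ball 0 r →
      MeasurableSet D → MemLp f p (volume.restrict D) →
      ∀ (ε : ℝ) (φ : 𝔼 → ℝ), 0 < ε → ε ≤ r → IsMollifierAt n ε φ →
      ∃ V : 𝔼 → ℝ, ContinuousOn V D ∧
        (∀ x ∈ D, |V x| ≤ A * r ^ (2 - (n : ℝ) * (p⁻¹).toReal) *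
          (eLpNorm f p (volume.restrict D)).toReal) ∧
        ∀ x ∈ D, ∃ ℓ, HasLap V x ℓ ∧ |∫ y in D, f y * φ (x - y)| ≤ ℓ := by
  obtain ⟨hp1, hnp⟩ := conjExponent_facts hn hp
  have hn1 : 1 ≤ n := by omega
  have hconj := ENNReal.HolderConjugate.conjExponent hp1.le
  set q := p.conjExponent with hq
  have hpq := ENNReal.HolderConjugate.inv_add_inv_eq_one p q
  have hqinv : (q⁻¹).toReal = 1 - (p⁻¹).toReal := by
    have h1 : p⁻¹ ≠ ⊤ := ENNReal.inv_ne_top.2 (by positivity)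
    have h2 : q⁻¹ ≠ ⊤ := by
      intro h; rw [h] at hpq; simp at hpq
    have := congrArg ENNReal.toReal hpq
    rw [ENNReal.toReal_add h1 h2] at this
    simp at this
    simp only [ENNReal.toReal_inv]
    linarith
  have hpinv1 : (p⁻¹).toReal < 1 := by
    rw [← ENNReal.toReal_one]
    exact (ENNReal.toReal_lt_toReal (ENNReal.inv_ne_top.2 (by positivity)) (by simp)).2
      (ENNReal.inv_lt_one.2 hp1)
  have hq1 : 1 ≤ q := by
    rw [← ENNReal.inv_le_one, ← hpq]; exact le_add_self
  have hqt : q ≠ ⊤ := by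
    intro h
    rw [h] at hqinv
    simp at hqinv
    simp at hpinv1
    linarith
  have hq0 : 0 < q.toReal := ENNReal.toReal_pos (by positivity) hqt
  -- Here n/q = n - n/p > n - 2 because p > n/2. For a in this gap, ‖z‖^(-a) controls the
  -- fundamental solution, including the logarithm when n = 2, and is locally in L^q.
  obtain ⟨a, ha1, ha2⟩ : ∃ a : ℝ, (n : ℝ) - 2 < a ∧ a < n * (q⁻¹).toReal :=
    exists_between (by rw [hqinv]; linarith)
  have haq : a * q.toReal < n := by
    rw [ENNReal.toReal_inv, ← div_eq_mul_inv, lt_div_iff₀ hq0] at ha2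
    exact ha2
  obtain ⟨C₁, hC₁, hN⟩ := exists_regularized_fundamental_solution hn ha1
  obtain ⟨C₂, hC₂, hJ⟩ := exists_eLpNorm_norm_rpow_ball_le hn1 hq1 hqt haq
  set κ : ℝ := 2 ^ n * (volume.real (Metric.ball (0 : 𝔼) 1))⁻¹ with hκ
  have hκ0 : 0 < κ := by
    have : 0 < volume.real (Metric.ball (0 : 𝔼) 1) :=
      ENNReal.toReal_pos (Metric.measure_ball_pos _ _ one_pos).ne' measure_ball_lt_top.ne
    positivity
  refine ⟨κ * C₁ * (C₁ * C₂), by positivity, ?_⟩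
  intro r D f hr hDr hDm hf ε φ hε hεr hφ
  obtain ⟨N, ℓ, hN2, hℓc, hNl, hℓ0, hℓε, hNb⟩ := hN r ε hε hεr
  set μ : Measure 𝔼 := volume.restrict D with hμ
  have hDfin : volume D < ⊤ := (measure_mono hDr).trans_lt measure_ball_lt_top
  have : IsFiniteMeasure μ := ⟨by simpa [hμ] using hDfin⟩
  have hfi : Integrable f μ := hf.integrable hp1.le
  have hY := isCompact_closedBall (0 : 𝔼) r
  have hYm : ∀ᵐ y ∂μ, y ∈ Metric.closedBall (0 : 𝔼) r :=
    (ae_restrict_mem hDm).mono fun y hy => Metric.ball_subset_closedBall (hDr hy)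
  have hk2 : ContDiffOn ℝ 2 (fun w : 𝔼 × 𝔼 => N (w.1 - w.2)) univ :=
    (hN2.comp (contDiff_fst.sub contDiff_snd)).contDiffOn
  -- Domination suffices: V need not solve a Poisson equation, since the Laplacian of κ C₁ (|f| * N)
  -- is κ C₁ (|f| * ℓ) ≥ |f| * |φ|.
  have hφ' : ∀ z, |φ z| ≤ κ * C₁ * ℓ z := by
    intro z
    rcases le_or_gt ‖z‖ ε with hz | hz
    · calc |φ z| ≤ κ * (ε ^ n)⁻¹ := hφ.abs_le z
        _ ≤ κ * (C₁ * ℓ z) := by gcongr; exact hℓε z hz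
        _ = _ := by ring
    · rw [hφ.eq_zero z hz, abs_zero]
      have := hℓ0 z
      positivity
  refine ⟨fun x => κ * C₁ * ∫ y, |f y| * N (x - y) ∂μ, ?_, ?_, ?_⟩
  · intro x hx
    exact ((continuousAt_integral_kernel (k := fun w => N (w.1 - w.2)) hYm hY isOpen_univ
      hk2.continuousOn hfi.abs (x := x) (by simp)).const_mul _).continuousWithinAt
  · intro x hx
    rw [abs_mul, abs_of_pos (by positivity), mul_assoc (κ * C₁), mul_assoc (κ * C₁)]
    refine mul_le_mul_of_nonneg_left ?_ (by positivity)
    have hfp : eLpNorm f p μ ≠ ⊤ := hf.2.ne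
    have hae : ∀ᵐ y ∂μ, y ∈ D ∧ y ≠ x := by
      refine (ae_restrict_mem hDm).and ?_
      have : Nontrivial 𝔼 := by
        have : Nonempty (Fin n) := ⟨⟨0, hn1⟩⟩
        infer_instance
      exact ae_restrict_of_ae (Measure.ae_ne volume x)
    have hxr : ‖x‖ < r := by simpa using hDr hx
    have hsub : D ⊆ Metric.ball x (2 * r) := by
      intro y hy
      have hyr : ‖y‖ < r := by simpa using hDr hy
      rw [Metric.mem_ball, dist_eq_norm]
      linarith [norm_sub_le y x]
    have hkey : ‖∫ y, |f y| * N (x - y) ∂μ‖ₑ ≤ ENNReal.ofReal (C₁ * r ^ (a - n + 2)) *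
        (eLpNorm f p μ * ENNReal.ofReal (C₂ * r ^ ((n : ℝ) * (q⁻¹).toReal - a))) := by
      calc ‖∫ y, |f y| * N (x - y) ∂μ‖ₑ ≤ ∫⁻ y, ‖|f y| * N (x - y)‖ₑ ∂μ :=
            enorm_integral_le_lintegral_enorm _
        _ ≤ ∫⁻ y, ENNReal.ofReal (C₁ * r ^ (a - n + 2)) * ‖(f • fun y => ‖x - y‖ ^ (-a)) y‖ₑ ∂μ := by
            refine lintegral_mono_ae (hae.mono fun y hy => ?_)
            have hxy : x - y ≠ 0 := sub_ne_zero.2 hy.2.symm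
            have h1 : ‖x - y‖ ≤ 2 * r := by
              have := hsub hy.1
              rw [Metric.mem_ball, dist_comm, dist_eq_norm] at this
              exact this.le
            have h2 := hNb _ hxy h1
            rw [← Real.enorm_of_nonneg (by positivity), ← enorm_mul]
            rw [Real.enorm_eq_ofReal_abs, Real.enorm_eq_ofReal_abs]
            refine ENNReal.ofReal_le_ofReal ?_
            simp only [Pi.smul_apply', smul_eq_mul]
            rw [abs_mul, abs_abs, abs_mul (C₁ * _), abs_mul (f y), abs_of_pos (by positivity : 0 < C₁ * r ^ (a - n + 2)),
              abs_of_nonneg (by positivity : 0 ≤ ‖x - y‖ ^ (-a))]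
            calc |f y| * |N (x - y)| ≤ |f y| * (C₁ * r ^ (a - n + 2) * ‖x - y‖ ^ (-a)) := by gcongr
              _ = _ := by ring
        _ = ENNReal.ofReal (C₁ * r ^ (a - n + 2)) * eLpNorm (f • fun y => ‖x - y‖ ^ (-a)) 1 μ := by
            rw [lintegral_const_mul' _ _ ENNReal.ofReal_ne_top, eLpNorm_one_eq_lintegral_enorm]
        _ ≤ _ := by
            refine mul_le_mul_right ?_ _
            refine (eLpNorm_smul_le_mul_eLpNorm (p := p) (q := q) ?_ hf.1).trans ?_
            · exact (by fun_prop : Measurable fun y : 𝔼 => ‖x - y‖ ^ (-a)).aestronglyMeasurable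
            · exact mul_le_mul_right ((eLpNorm_mono_measure _ (Measure.restrict_mono hsub le_rfl)).trans
                (hJ r x hr)) _
    have h3 := ENNReal.toReal_mono (by finiteness) hkey
    rw [toReal_enorm, Real.norm_eq_abs, ENNReal.toReal_mul, ENNReal.toReal_mul,
      ENNReal.toReal_ofReal (by positivity), ENNReal.toReal_ofReal (by positivity)] at h3
    refine h3.trans_eq ?_
    have h4 : r ^ (2 - (n : ℝ) * (p⁻¹).toReal)
        = r ^ (a - n + 2) * r ^ ((n : ℝ) * (q⁻¹).toReal - a) := by
      rw [← Real.rpow_add hr, hqinv]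
      congr 1
      ring
    rw [h4]
    ring
  · intro x hx
    have hlap := (hasLap_integral_kernel (k := fun w => N (w.1 - w.2)) hYm hY isOpen_univ
      hk2 hfi.abs (x := x) (ℓ := fun y => ℓ (x - y)) (by simp)
      (fun y _ => (hNl (x - y)).comp_sub_const)).const_mul (κ * C₁)
    refine ⟨_, hlap, ?_⟩
    have hi1 : Integrable (fun y => |f y| * ℓ (x - y)) μ :=
      integrable_kernel (O := univ) (k := fun w => ℓ (w.1 - w.2)) hYm hY
        (by fun_prop) hfi.abs (x := x) (by simp)
    rw [← integral_const_mul]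
    refine (abs_integral_le_integral_abs).trans ?_
    refine integral_mono_of_nonneg (Eventually.of_forall fun y => abs_nonneg _) (hi1.const_mul _)
      (Eventually.of_forall fun y => ?_)
    simp only [abs_mul]
    calc |f y| * |φ (x - y)| ≤ |f y| * (κ * C₁ * ℓ (x - y)) := by gcongr; exact hφ' _
      _ = _ := by ring

end NewtonianPotential

/-! ### The maximum principle for distributional solutions, by mollification. -/

section DistributionalMaximumPrinciple

variable {n : ℕ}

local notation "𝔼" => EuclideanSpace ℝ (Fin n)

theorem exists_smooth_mollifier (n : ℕ) {ε : ℝ} (hε : 0 < ε) :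
    ∃ φ : EuclideanSpace ℝ (Fin n) → ℝ, ContDiff ℝ ∞ φ ∧ HasCompactSupport φ ∧ IsMollifierAt n ε φ ∧ (∀ z, 0 ≤ φ z) ∧
      ∫ z, φ z = 1 := by
  -- The bump is 1 on the ball of radius ε/2, so after normalization it is at most the inverse
  -- volume of that ball; hence the factor 2^n.
  let b : ContDiffBump (0 : EuclideanSpace ℝ (Fin n)) := ⟨ε / 2, ε, by positivity, by linarith⟩
  refine ⟨b.normed volume, b.contDiff_normed, b.hasCompactSupport_normed,
    ⟨b.continuous_normed, fun z => ?_, fun z hz => ?_⟩, b.nonneg_normed, b.integral_normed⟩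
  · rw [abs_of_nonneg (b.nonneg_normed z)]
    refine (b.normed_le_div_measure_closedBall_rIn volume z).trans_eq ?_
    have h1 : volume.real (Metric.closedBall (0 : EuclideanSpace ℝ (Fin n)) (ε / 2))
        = (ε / 2) ^ n * volume.real (Metric.ball (0 : EuclideanSpace ℝ (Fin n)) 1) := by
      rw [Measure.real, Measure.addHaar_closedBall _ _ (by positivity), ENNReal.toReal_mul,
        ENNReal.toReal_ofReal (by positivity), finrank_euclideanSpace_fin, Measure.real]
    change 1 / volume.real (Metric.closedBall (0 : EuclideanSpace ℝ (Fin n)) (ε / 2)) = _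
    rw [h1, div_pow]
    field_simp
  · by_contra h
    have : z ∈ Function.support (b.normed volume) := h
    rw [b.support_normed_eq, mem_ball_zero_iff] at this
    exact hz.not_gt this

theorem laplacian_comp_const_sub {φ : 𝔼 → ℝ} (hφ : ContDiff ℝ 2 φ) (x y : 𝔼) :
    (Δ fun z => φ (x - z)) y = (Δ φ) (x - y) :=
  ((hφ.comp (contDiff_const.sub contDiff_id)).hasLap y).unique (hφ.hasLap (x - y)).comp_const_sub

theorem tsupport_comp_const_sub_subset {ε : ℝ} {φ : 𝔼 → ℝ} (hφ : IsMollifierAt n ε φ) (x : 𝔼) :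
    tsupport (fun y => φ (x - y)) ⊆ Metric.closedBall x ε := by
  refine closure_minimal (fun y hy => ?_) Metric.isClosed_closedBall
  by_contra h
  refine hy (hφ.eq_zero _ ?_)
  rwa [Metric.mem_closedBall, not_le, dist_comm, dist_eq_norm] at h

/-- Maximum principle for continuous distributional solutions of `Δ u = f`, given bounds for
potentials dominating the mollifications of `f`. -/
theorem add_le_of_distributional_laplacian (hn : 1 ≤ n) {D : Set 𝔼} (hD : IsOpen D)
    (hDb : Bornology.IsBounded D) {u f w : 𝔼 → ℝ} (hu : ContinuousOn u (closure D))
    (heq : ∀ φ : 𝔼 → ℝ, ContDiff ℝ ∞ φ → HasCompactSupport φ → tsupport φ ⊆ D →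
      ∫ x in D, u x * (Δ φ) x = ∫ x in D, f x * φ x)
    (hw : ContinuousOn w D) (hwl : ∀ x ∈ D, HasLap w x 0)
    (hbd : ∀ z ∈ closure D \ D, ∀ s > 0, ∀ᶠ x in 𝓝[D] z, u x + w x < s)
    {A ε₀ : ℝ} (hε₀ : 0 < ε₀)
    (hV : ∀ (ε : ℝ) (φ : 𝔼 → ℝ), 0 < ε → ε ≤ ε₀ → IsMollifierAt n ε φ →
      ∃ V : 𝔼 → ℝ, ContinuousOn V D ∧ (∀ x ∈ D, |V x| ≤ A) ∧
        ∀ x ∈ D, ∃ ℓ, HasLap V x ℓ ∧ |∫ y in D, f y * φ (x - y)| ≤ ℓ) :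
    ∀ x ∈ D, u x + w x ≤ 2 * A := by
  intro x₀ hx₀
  have hA : 0 ≤ A := by
    obtain ⟨φ, -, -, hφ, -⟩ := exists_smooth_mollifier n hε₀
    obtain ⟨V, -, h, -⟩ := hV ε₀ φ hε₀ le_rfl hφ
    exact (abs_nonneg _).trans (h x₀ hx₀)
  have hcD : IsCompact (closure D) := hDb.isCompact_closure
  have hcont : ContinuousOn (fun x => u x + w x) D := (hu.mono subset_closure).add hw
  have key : ∀ s > 0, u x₀ + w x₀ ≤ 2 * A + 3 * s := by
    intro s hs
    -- The boundary condition keeps K away from ∂D, so K is compact and leaves room to mollify at a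
    -- small scale.
    set K := {x | x ∈ D ∧ s ≤ u x + w x} with hK
    have hKD : K ⊆ D := fun x hx => hx.1
    by_cases hxK : x₀ ∈ K
    swap
    · have : u x₀ + w x₀ < s := not_le.1 fun h => hxK ⟨hx₀, h⟩
      linarith
    have hKclosed : IsClosed K := by
      refine isClosed_of_closure_subset fun z hz => ?_
      have hfreq : ∃ᶠ x in 𝓝 z, x ∈ K := mem_closure_iff_frequently.1 hz
      by_cases hzD : z ∈ D
      · refine ⟨hzD, not_lt.1 fun hlt => ?_⟩
        have := (hcont.continuousAt (hD.mem_nhds hzD)).eventually_lt continuousAt_const hlt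
        exact hfreq (this.mono fun x hx hxK => hx.not_ge hxK.2)
      · have := hbd z ⟨closure_mono hKD hz, hzD⟩ s hs
        rw [eventually_nhdsWithin_iff] at this
        exact (hfreq (this.mono fun x hx hxK => (hx hxK.1).not_ge hxK.2)).elim
    have hKc : IsCompact K := hcD.of_isClosed_subset hKclosed (hKD.trans subset_closure)
    obtain ⟨δ, hδ, hδD⟩ := hKc.exists_cthickening_subset_open hD hKD
    obtain ⟨ε₁, hε₁, hunif⟩ := Metric.uniformContinuousOn_iff.1
      (hcD.uniformContinuousOn_of_continuous hu) s hs
    set ε := min δ (min ε₀ (ε₁ / 2)) with hε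
    have hε0 : 0 < ε := lt_min hδ (lt_min hε₀ (by positivity))
    have hεδ : ε ≤ δ := min_le_left _ _
    have hεε₀ : ε ≤ ε₀ := (min_le_right _ _).trans (min_le_left _ _)
    have hεε₁ : ε < ε₁ := by
      have : ε ≤ ε₁ / 2 := (min_le_right _ _).trans (min_le_right _ _)
      linarith
    obtain ⟨φ, hφs, hφc, hφ, hφ0, hφ1⟩ := exists_smooth_mollifier n hε0
    obtain ⟨V, hVc, hVA, hVl⟩ := hV ε φ hε0 hεε₀ hφ
    have hφ2 : ContDiff ℝ 2 φ := by
      exact_mod_cast contDiff_infty.1 hφs 2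
    have hball : ∀ x ∈ K, Metric.closedBall x ε ⊆ D := fun x hx =>
      (Metric.closedBall_subset_cthickening hx ε).trans
        ((Metric.cthickening_mono hεδ K).trans hδD)
    set μ : Measure 𝔼 := volume.restrict D with hμ
    have hDfin : volume D < ⊤ := hDb.measure_lt_top
    have : IsFiniteMeasure μ := ⟨by simpa [hμ] using hDfin⟩
    have hui : Integrable u μ :=
      (hu.integrableOn_compact hcD).mono_set subset_closure
    have hYm : ∀ᵐ y ∂μ, y ∈ closure D :=
      (ae_restrict_mem hD.measurableSet).mono fun y hy => subset_closure hy
    have hk2 : ContDiffOn ℝ 2 (fun p : 𝔼 × 𝔼 => φ (p.1 - p.2)) univ :=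
      (hφ2.comp (contDiff_fst.sub contDiff_snd)).contDiffOn
    -- For x in K the function φ(x - ·) is supported in D; testing the equation with it shows that U
    -- has Laplacian f * φ at x.
    set U : 𝔼 → ℝ := fun x => ∫ y, u y * φ (x - y) ∂μ with hU
    have hUc : ∀ x, ContinuousAt U x := fun x =>
        continuousAt_integral_kernel (k := fun p => φ (p.1 - p.2)) hYm hcD isOpen_univ
          hk2.continuousOn hui (x := x) (by simp)
    have hUl : ∀ x ∈ K, HasLap U x (∫ y in D, f y * φ (x - y)) := by
      intro x hx
      have h1 := hasLap_integral_kernel (k := fun p => φ (p.1 - p.2)) hYm hcD isOpen_univ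
        hk2 hui (x := x) (ℓ := fun y => (Δ φ) (x - y)) (by simp)
        (fun y _ => (hφ2.hasLap (x - y)).comp_sub_const)
      have h2 := heq (fun y => φ (x - y)) (hφs.comp (contDiff_const.sub contDiff_id))
        (HasCompactSupport.of_support_subset_isCompact (isCompact_closedBall x ε)
          (subset_closure.trans (tsupport_comp_const_sub_subset hφ x)))
        ((tsupport_comp_const_sub_subset hφ x).trans (hball x hx))
      simp_rw [laplacian_comp_const_sub hφ2] at h2
      rwa [h2] at h1
    have hUu : ∀ x ∈ K, |U x - u x| ≤ s := by
      intro x hx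
      have hφi : Integrable (fun y => φ (x - y)) μ := by
        have := integrable_kernel (k := fun p => φ (p.1 - p.2)) hYm hcD
          hk2.continuousOn (integrable_const (1 : ℝ)) (x := x) (by simp)
        simpa using this
      have hφint : ∫ y, φ (x - y) ∂μ = 1 := by
        rw [hμ, setIntegral_eq_integral_of_forall_compl_eq_zero, integral_sub_left_eq_self φ, hφ1]
        intro y hy
        by_contra h
        exact hy (hball x hx (tsupport_comp_const_sub_subset hφ x (subset_closure h)))
      have hi : Integrable (fun y => u y * φ (x - y)) μ :=
        integrable_kernel (k := fun p => φ (p.1 - p.2)) hYm hcD hk2.continuousOn hui (by simp)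
      have e : U x - u x = ∫ y, (u y - u x) * φ (x - y) ∂μ := by
        simp_rw [sub_mul]
        rw [integral_sub hi (hφi.const_mul _), integral_const_mul, hφint, mul_one]
      rw [e]
      refine abs_integral_le_integral_abs.trans ?_
      calc ∫ y, |(u y - u x) * φ (x - y)| ∂μ ≤ ∫ y, s * φ (x - y) ∂μ := by
            refine integral_mono_of_nonneg (Eventually.of_forall fun y => abs_nonneg _)
              (hφi.const_mul s) (hYm.mono fun y hy => ?_)
            simp only [abs_mul, abs_of_nonneg (hφ0 _)]
            by_cases hxy : φ (x - y) = 0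
            · simp [hxy]
            · refine mul_le_mul_of_nonneg_right ?_ (hφ0 _)
              have h1 : ‖x - y‖ ≤ ε := not_lt.1 fun h => hxy (hφ.eq_zero _ h)
              have h2 := hunif y hy x (subset_closure (hKD hx)) (by
                rw [dist_comm, dist_eq_norm]; linarith)
              rw [Real.dist_eq] at h2
              exact h2.le
        _ = s := by rw [integral_const_mul, hφint, mul_one]
    -- On K \ interior K: u + w ≤ s, U ≤ u + s and V ≤ A, hence the bound A + 2s. Returning from U +
    -- V to u costs another A + s.
    have hmax := le_of_hasLap_nonneg hn hKc (Φ := fun x => (U x + V x) + w x) (B := A + 2 * s)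
      (((ContinuousOn.add (fun x _ => (hUc x).continuousWithinAt) (hVc.mono hKD)).add
        (hw.mono hKD))) ?_ ?_ x₀ hxK
    · have h1 := abs_le.1 (hUu x₀ hxK)
      have h2 := abs_le.1 (hVA x₀ hx₀)
      linarith [h1.1, h2.1]
    · intro x hx
      have hxK := interior_subset hx
      obtain ⟨ℓ, hl, hle⟩ := hVl x (hKD hxK)
      exact ⟨_, by linarith [(abs_le.1 hle).1], ((hUl x hxK).add hl).add (hwl x (hKD hxK))⟩
    · rintro x ⟨hxK, hxi⟩
      -- A point of K with u + w > s has a neighbourhood in K by continuity, so it is interior.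
      have h0 : u x + w x ≤ s := by
        by_contra! h
        refine hxi (mem_interior_iff_mem_nhds.2 ?_)
        have := continuousAt_const.eventually_lt (hcont.continuousAt (hD.mem_nhds hxK.1)) h
        filter_upwards [this, hD.mem_nhds hxK.1] with y hy hyD using ⟨hyD, hy.le⟩
      have h1 := abs_le.1 (hUu x hxK)
      have h2 := abs_le.1 (hVA x (hKD hxK))
      linarith [h1.2, h2.2]
  have hlim : Tendsto (fun s : ℝ => 2 * A + 3 * s) (𝓝[>] 0) (𝓝 (2 * A)) := by
    have : Continuous fun s : ℝ => 2 * A + 3 * s := by fun_prop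
    simpa using (this.tendsto 0).mono_left nhdsWithin_le_nhds
  exact ge_of_tendsto hlim (eventually_mem_nhdsWithin.mono key)

end DistributionalMaximumPrinciple

/-! ### Decay of oscillation at the boundary point and its iteration. -/

section BoundaryRegularity

variable {n : ℕ}

local notation "𝔼" => EuclideanSpace ℝ (Fin n)

theorem laplacian_eq_zero_of_notMem_tsupport {φ : 𝔼 → ℝ} {x : 𝔼} (hx : x ∉ tsupport φ) :
    (Δ φ) x = 0 := by
  have h := InnerProductSpace.laplacian_congr_nhds (notMem_tsupport_iff_eventuallyEq.1 hx)
  rw [h.self_of_nhds]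
  exact congrFun (InnerProductSpace.laplacian_const (E := 𝔼) (c := (0 : ℝ))) x

/-- A distributional equation on `Ω` restricts to measurable subsets of `Ω`. -/
theorem distributional_equation_mono {Ω D : Set 𝔼} (hDΩ : D ⊆ Ω) (hΩm : MeasurableSet Ω)
    {u f : 𝔼 → ℝ}
    (heq : ∀ φ : 𝔼 → ℝ, ContDiff ℝ ∞ φ → HasCompactSupport φ → tsupport φ ⊆ Ω →
      ∫ x in Ω, u x * (Δ φ) x = ∫ x in Ω, f x * φ x) :
    ∀ φ : 𝔼 → ℝ, ContDiff ℝ ∞ φ → HasCompactSupport φ → tsupport φ ⊆ D →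
      ∫ x in D, u x * (Δ φ) x = ∫ x in D, f x * φ x := by
  intro φ h1 h2 h3
  have h := heq φ h1 h2 (h3.trans hDΩ)
  rw [setIntegral_eq_of_subset_of_forall_sdiff_eq_zero hΩm hDΩ,
    setIntegral_eq_of_subset_of_forall_sdiff_eq_zero hΩm hDΩ] at h
  · exact h
  · intro x hx
    rw [image_eq_zero_of_notMem_tsupport fun hxt => hx.2 (h3 hxt), mul_zero]
  · intro x hx
    rw [laplacian_eq_zero_of_notMem_tsupport fun hxt => hx.2 (h3 hxt), mul_zero]

/-- The gain in the oscillation coming from a portion `ν` of the sphere outside the domain. -/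
noncomputable def decayGain (n : ℕ) (τ ν : ℝ) : ℝ := (1 - τ ^ 2) / (1 + τ) ^ n * ν / sphereArea n

theorem decayGain_pos {τ ν : ℝ} (hτ0 : 0 < τ) (hτ1 : τ < 1) (hν : 0 < ν) :
    0 < decayGain n τ ν := by
  have := sphereArea_pos n
  have : 0 < 1 - τ ^ 2 := by nlinarith
  unfold decayGain
  positivity

/-- One-sided decay of the oscillation from a ball to a smaller concentric ball. -/
theorem exists_one_sided_decay (hn : 2 ≤ n) {p : ℝ≥0∞} (hp : (n : ℝ≥0∞) / 2 < p) :
    ∃ A > 0, ∀ (Ω : Set 𝔼) (u f : 𝔼 → ℝ) (r τ ν c G M : ℝ), IsOpen Ω → 0 < r →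
      τ < 1 → 0 < ν → 0 ≤ G → 0 ≤ M →
      ENNReal.ofReal (ν * r ^ (n - 1)) ≤ μHE[n - 1] (Metric.sphere (0 : 𝔼) r ∩ Ωᶜ) →
      ContinuousOn u (closure Ω) → MemLp f p (volume.restrict Ω) →
      (∀ φ : 𝔼 → ℝ, ContDiff ℝ ∞ φ → HasCompactSupport φ → tsupport φ ⊆ Ω →
        ∫ x in Ω, u x * (Δ φ) x = ∫ x in Ω, f x * φ x) →
      (∀ z ∈ frontier Ω, ‖z‖ ≤ r → u z - c ≤ G) →
      (∀ x ∈ Ω ∩ Metric.ball 0 r, u x - c ≤ M) →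
      ∀ x ∈ Ω ∩ Metric.ball 0 (τ * r), u x - c ≤ (1 - decayGain n τ ν) * M + G +
        A * r ^ (2 - (n : ℝ) * (p⁻¹).toReal) * lpNormOn p (Ω ∩ Metric.ball 0 r) f := by
  obtain ⟨A, hA, hpot⟩ := exists_potential hn hp
  refine ⟨2 * A, by positivity, ?_⟩
  intro Ω u f r τ ν c G M hΩ hr hτ1 hν hG hM hE hu hf heq hfr hbound x hx
  set D := Ω ∩ Metric.ball 0 r with hD
  have hDo : IsOpen D := hΩ.inter Metric.isOpen_ball
  have hDb : Bornology.IsBounded D := Metric.isBounded_ball.subset inter_subset_right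
  obtain ⟨b, hbc, hbl, hb01, hbz, hblow⟩ := exists_harmonic_barrier (by omega : 1 ≤ n) hr hτ1 hν
    (Metric.isClosed_sphere.inter hΩ.isClosed_compl) inter_subset_left hE
  have hDcl : closure D ⊆ closure Ω := closure_mono inter_subset_left
  -- The comparison function is w = M b - c - G - M. At a point of ∂Ω, u ≤ c + G and b ≤ 1; at a
  -- point of the sphere inside Ω, u ≤ c + M nearby and b → 0. In both cases the upper limit of u +
  -- w is at most 0.
  have hmain := add_le_of_distributional_laplacian (by omega : 1 ≤ n) hDo hDb
    (u := u) (f := f) (w := fun x => M * b x + (-c - G - M)) (hu.mono hDcl)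
    (distributional_equation_mono inter_subset_left hΩ.measurableSet heq)
    ((continuousOn_const.mul (hbc.mono inter_subset_right)).add continuousOn_const)
    (fun z hz => by simpa using ((hbl z hz.2).const_mul M).add_const (-c - G - M)) ?_ hr
    (fun ε φ hε hεr hφ => ?_) (A := A * r ^ (2 - (n : ℝ) * (p⁻¹).toReal) *
      lpNormOn p (Ω ∩ Metric.ball 0 r) f)
  · rcases le_or_gt τ 0 with hτ0 | hτ0
    · have := hx.2
      rw [mem_ball_zero_iff] at this
      nlinarith [norm_nonneg x]
    have hxr : x ∈ Metric.ball (0 : 𝔼) r := Metric.ball_subset_ball (by nlinarith) hx.2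
    have h1 := hmain x ⟨hx.1, hxr⟩
    have h2 : decayGain n τ ν * M ≤ b x * M := mul_le_mul_of_nonneg_right (hblow x hx.2) hM
    linarith
  · rintro z ⟨hzc, hzD⟩ s hs
    have hzr : ‖z‖ ≤ r := by
      have : z ∈ Metric.closedBall (0 : 𝔼) r :=
        Metric.closure_ball_subset_closedBall (closure_mono inter_subset_right hzc)
      simpa using this
    by_cases hzΩ : z ∈ Ω
    · have hzr' : ‖z‖ = r := le_antisymm hzr (not_lt.1 fun h => hzD ⟨hzΩ, by simpa using h⟩)
      have ht := (hbz z ⟨by simpa using hzr', fun h => h.2 hzΩ⟩).const_mul M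
      rw [mul_zero] at ht
      filter_upwards [nhdsWithin_le_nhds (ht.eventually_lt_const hs), self_mem_nhdsWithin]
        with y hy hyD
      linarith [hbound y hyD]
    · have hzf : z ∈ frontier Ω := by
        rw [hΩ.frontier_eq]; exact ⟨hDcl hzc, hzΩ⟩
      have h1 := hfr z hzf hzr
      have ht : Tendsto u (𝓝[D] z) (𝓝 (u z)) :=
        ((hu.mono hDcl) z hzc).mono_left (nhdsWithin_mono z subset_closure)
      filter_upwards [ht.eventually_lt_const (by linarith : u z < c + G + s), self_mem_nhdsWithin]
        with y hy hyD
      have := mul_le_mul_of_nonneg_left (hb01 y hyD.2).2 hM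
      linarith
  · exact hpot r D f hr inter_subset_right hDo.measurableSet
      (hf.mono_measure (Measure.restrict_mono inter_subset_left le_rfl)) ε φ hε hεr hφ

/-- Decay of the oscillation of solutions, with constant `A`, from a ball of radius `r` to the
concentric ball of radius `τ * r`, when the complement of the domain contains a portion `ν` of the
sphere of radius `r`. -/
def HasOscillationDecay (n : ℕ) (p : ℝ≥0∞) (A : ℝ) : Prop :=
  ∀ (Ω : Set (EuclideanSpace ℝ (Fin n))) (u f : EuclideanSpace ℝ (Fin n) → ℝ)
    (r τ ν c G M : ℝ), IsOpen Ω → 0 < r → τ < 1 → 0 < ν → 0 ≤ G → 0 ≤ M →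
    ENNReal.ofReal (ν * r ^ (n - 1)) ≤
      μHE[n - 1] (Metric.sphere (0 : EuclideanSpace ℝ (Fin n)) r ∩ Ωᶜ) →
    ContinuousOn u (closure Ω) → MemLp f p (volume.restrict Ω) →
    (∀ φ : EuclideanSpace ℝ (Fin n) → ℝ, ContDiff ℝ ∞ φ → HasCompactSupport φ → tsupport φ ⊆ Ω →
      ∫ x in Ω, u x * (Δ φ) x = ∫ x in Ω, f x * φ x) →
    (∀ z ∈ frontier Ω, ‖z‖ ≤ r → |u z - c| ≤ G) →
    (∀ x ∈ Ω ∩ Metric.ball 0 r, |u x - c| ≤ M) →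
    ∀ x ∈ Ω ∩ Metric.ball 0 (τ * r), |u x - c| ≤ (1 - decayGain n τ ν) * M + G +
      A * r ^ (2 - (n : ℝ) * (p⁻¹).toReal) * lpNormOn p (Ω ∩ Metric.ball 0 r) f

theorem exists_hasOscillationDecay (hn : 2 ≤ n) {p : ℝ≥0∞} (hp : (n : ℝ≥0∞) / 2 < p) :
    ∃ A > 0, HasOscillationDecay n p A := by
  obtain ⟨A, hA, h⟩ := exists_one_sided_decay hn hp
  refine ⟨A, hA, ?_⟩
  intro Ω u f r τ ν c G M hΩ hr hτ1 hν hG hM hE hu hf heq hfr hbound x hx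
  have h1 := h Ω u f r τ ν c G M hΩ hr hτ1 hν hG hM hE hu hf heq
    (fun z hz hzr => (abs_le.1 (hfr z hz hzr)).2) (fun z hz => (abs_le.1 (hbound z hz)).2) x hx
  have h2 := h Ω (fun y => -u y) (fun y => -f y) r τ ν (-c) G M hΩ hr hτ1 hν hG hM hE hu.neg hf.neg
    (fun φ a₁ a₂ a₃ => by
      simp only [neg_mul, integral_neg, heq φ a₁ a₂ a₃])
    (fun z hz hzr => by linarith [(abs_le.1 (hfr z hz hzr)).1])
    (fun z hz => by linarith [(abs_le.1 (hbound z hz)).1]) x hx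
  have h3 : lpNormOn p (Ω ∩ Metric.ball 0 r) (fun y => -f y)
      = lpNormOn p (Ω ∩ Metric.ball 0 r) f := by
    simp only [lpNormOn]
    rw [show (fun y => -f y) = -f from rfl, eLpNorm_neg]
  rw [h3] at h2
  exact abs_le.2 ⟨by linarith, h1⟩

theorem lpNormOn_nonneg (p : ℝ≥0∞) (s : Set 𝔼) (h : 𝔼 → ℝ) : 0 ≤ lpNormOn p s h :=
  ENNReal.toReal_nonneg

theorem lpNormOn_mono {p : ℝ≥0∞} {s t : Set 𝔼} {h : 𝔼 → ℝ} (hst : s ⊆ t)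
    (ht : MemLp h p (volume.restrict t)) : lpNormOn p s h ≤ lpNormOn p t h :=
  ENNReal.toReal_mono ht.2.ne (eLpNorm_mono_measure _ (Measure.restrict_mono hst le_rfl))

/-- A bounded continuous function on an open set is bounded everywhere by its essential supremum. -/
theorem abs_le_lpNormOn_top {s : Set 𝔼} (hs : IsOpen s) {u : 𝔼 → ℝ} (hu : ContinuousOn u s) {B : ℝ}
    (hB : ∀ x ∈ s, |u x| ≤ B) {x : 𝔼} (hx : x ∈ s) : |u x| ≤ lpNormOn ⊤ s u := by
  have hmem : MemLp u ⊤ (volume.restrict s) :=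
    memLp_top_of_bound (hu.aestronglyMeasurable hs.measurableSet) B
      ((ae_restrict_mem hs.measurableSet).mono fun y hy => hB y hy)
  have hae : ∀ᵐ y ∂(volume.restrict s), |u y| ≤ lpNormOn ⊤ s u := by
    filter_upwards [ae_le_eLpNormEssSup (f := u) (μ := volume.restrict s)] with y hy
    rw [← eLpNorm_exponent_top] at hy
    have := ENNReal.toReal_mono hmem.2.ne hy
    rwa [toReal_enorm, Real.norm_eq_abs] at this
  by_contra! hlt
  have hopen : IsOpen (s ∩ (fun y => |u y|) ⁻¹' Ioi (lpNormOn ⊤ s u)) :=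
    hu.abs.isOpen_inter_preimage hs isOpen_Ioi
  have hpos := hopen.measure_pos volume ⟨x, hx, hlt⟩
  rw [ae_restrict_iff' hs.measurableSet] at hae
  refine hpos.ne' (measure_mono_null ?_ hae)
  rintro y ⟨hy, hy'⟩ h
  exact (h hy).not_gt hy'

theorem holderSeminormAt_nonneg (s : Set 𝔼) (α : ℝ) (h : 𝔼 → ℝ) (x₀ : 𝔼) :
    0 ≤ holderSeminormAt s α h x₀ := Real.sInf_nonneg fun _ hK => hK.1

/-- The infimum is itself admissible: where ‖x - x₀‖^α > 0 one divides by it, and where it vanishes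
so does the left side. -/
theorem abs_sub_le_holderSeminormAt {s : Set 𝔼} {α : ℝ} {h : 𝔼 → ℝ} {x₀ : 𝔼}
    (hh : IsHolderAt s α h x₀) {x : 𝔼} (hx : x ∈ s) :
    |h x - h x₀| ≤ holderSeminormAt s α h x₀ * ‖x - x₀‖ ^ α := by
  obtain ⟨K, hK⟩ := hh
  have hne : {K : ℝ | 0 ≤ K ∧ ∀ x ∈ s, |h x - h x₀| ≤ K * ‖x - x₀‖ ^ α}.Nonempty :=
    ⟨max K 0, le_max_right _ _, fun y hy => (hK y hy).trans
      (mul_le_mul_of_nonneg_right (le_max_left _ _) (by positivity))⟩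
  rcases (by positivity : 0 ≤ ‖x - x₀‖ ^ α).eq_or_lt with h0 | h0
  · have := hK x hx
    rw [← h0] at this ⊢
    simpa using this
  · rw [← div_le_iff₀ h0]
    exact le_csInf hne fun L hL => (div_le_iff₀ h0).2 (hL.2 x hx)

theorem IsQuasiGeometric.le_pow {τ₁ τ₂ : ℝ} {r : ℕ → ℝ} (h : IsQuasiGeometric τ₁ τ₂ r)
    (h0 : r 0 = 1) (k : ℕ) : r k ≤ τ₂ ^ k := by
  have hτ : 0 ≤ τ₂ := (h.tau_pos.trans h.tau_lt).le
  induction k with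
  | zero => simp [h0]
  | succ k ih =>
    rw [pow_succ']
    exact (h.upper k).trans (mul_le_mul_of_nonneg_left ih hτ)

theorem IsQuasiGeometric.exists_between {τ₁ τ₂ : ℝ} {r : ℕ → ℝ} (h : IsQuasiGeometric τ₁ τ₂ r)
    (h0 : r 0 = 1) {t : ℝ} (ht : 0 < t) (ht1 : t < 1) : ∃ k, r (k + 1) ≤ t ∧ t < r k := by
  classical
  have hex : ∃ k, r k ≤ t := by
    obtain ⟨k, hk⟩ := exists_pow_lt_of_lt_one ht h.tau_lt_one
    exact ⟨k, (h.le_pow h0 k).trans hk.le⟩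
  have hne : Nat.find hex ≠ 0 := fun hz => by
    have := Nat.find_spec hex
    rw [hz, h0] at this
    linarith
  obtain ⟨k, hk⟩ := Nat.exists_eq_succ_of_ne_zero hne
  exact ⟨k, by simpa [hk] using Nat.find_spec hex, not_le.1 (Nat.find_min hex (by omega))⟩

/-- The contraction factor used in the iteration. -/
noncomputable def contractionGain (n : ℕ) (τ ν : ℝ) : ℝ := min (1 / 2) (decayGain n τ ν)

/-- The Hölder exponent for which the decay of the oscillation is preserved by scaling. -/
noncomputable def holderExponent (n : ℕ) (τ₁ τ₂ ν : ℝ) : ℝ :=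
  Real.log (1 + contractionGain n τ₂ ν / 2) / (-Real.log τ₁)

theorem contractionGain_pos {τ ν : ℝ} (hτ0 : 0 < τ) (hτ1 : τ < 1) (hν : 0 < ν) :
    0 < contractionGain n τ ν := lt_min (by norm_num) (decayGain_pos hτ0 hτ1 hν)

theorem holderExponent_pos {τ₁ τ₂ ν : ℝ} (h1 : 0 < τ₁) (h12 : τ₁ < τ₂) (h2 : τ₂ < 1) (hν : 0 < ν) :
    0 < holderExponent n τ₁ τ₂ ν := by
  have := contractionGain_pos (n := n) (h1.trans h12) h2 hν
  exact div_pos (Real.log_pos (by linarith))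
    (neg_pos.2 (Real.log_neg h1 (h12.trans h2)))

/-- The exponent `holderExponent` solves (1 + γ/2) τ₁^β = 1, and the left side decreases in β
because τ₁ < 1. -/
theorem one_le_mul_rpow_of_le_holderExponent {τ₁ τ₂ ν β : ℝ} (h1 : 0 < τ₁) (h12 : τ₁ < τ₂)
    (h2 : τ₂ < 1) (hν : 0 < ν) (hβ : β ≤ holderExponent n τ₁ τ₂ ν) :
    1 ≤ (1 + contractionGain n τ₂ ν / 2) * τ₁ ^ β := by
  have hg := contractionGain_pos (n := n) (h1.trans h12) h2 hν
  have hlog : Real.log τ₁ < 0 := Real.log_neg h1 (h12.trans h2)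
  have h3 : β * (-Real.log τ₁) ≤ Real.log (1 + contractionGain n τ₂ ν / 2) := by
    rwa [holderExponent, le_div_iff₀ (by linarith)] at hβ
  have hpos : 0 < 1 + contractionGain n τ₂ ν / 2 := by linarith
  rw [← Real.exp_log hpos, Real.rpow_def_of_pos h1, ← Real.exp_add]
  refine Real.one_le_exp ?_
  nlinarith

/-- The cost of one step between radii. The ratio τ₁ is absorbed by the restriction on β, so the
factor depends only on n, τ₂ and ν; this keeps τ₁ out of the final constant. -/
theorem IsQuasiGeometric.rpow_le_mul_rpow_succ {τ₁ τ₂ ν β : ℝ} {r : ℕ → ℝ}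
    (hr : IsQuasiGeometric τ₁ τ₂ r) (hν : 0 < ν) (hβ : 0 < β)
    (hβ0 : β ≤ holderExponent n τ₁ τ₂ ν) (k : ℕ) :
    r k ^ β ≤ (1 + contractionGain n τ₂ ν / 2) * r (k + 1) ^ β := by
  have hτβ := one_le_mul_rpow_of_le_holderExponent hr.tau_pos hr.tau_lt hr.tau_lt_one hν hβ0
  have hg0 := contractionGain_pos (n := n) (hr.tau_pos.trans hr.tau_lt) hr.tau_lt_one hν
  set γ := contractionGain n τ₂ ν with hγ
  have h1 : (τ₁ * r k) ^ β ≤ r (k + 1) ^ β :=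
    Real.rpow_le_rpow (mul_pos hr.tau_pos (hr.pos k)).le (hr.lower k) hβ.le
  rw [Real.mul_rpow hr.tau_pos.le (hr.pos k).le] at h1
  have h2 : 0 ≤ r k ^ β := Real.rpow_nonneg (hr.pos k).le β
  calc r k ^ β ≤ ((1 + γ / 2) * τ₁ ^ β) * r k ^ β := le_mul_of_one_le_left h2 hτβ
    _ = (1 + γ / 2) * (τ₁ ^ β * r k ^ β) := by ring
    _ ≤ _ := by gcongr

/-- Iteration of the decay of the oscillation along a quasi-geometric sequence of radii. -/
theorem HasOscillationDecay.abs_sub_le_mul_rpow {p : ℝ≥0∞} {A : ℝ} (hA : HasOscillationDecay n p A)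
    (hA0 : 0 < A) {Ω : Set 𝔼} (hΩ : IsOpen Ω) {u f : 𝔼 → ℝ} (huc : ContinuousOn u (closure Ω))
    (hf : MemLp f p (volume.restrict Ω))
    (heq : ∀ φ : 𝔼 → ℝ, ContDiff ℝ ∞ φ → HasCompactSupport φ → tsupport φ ⊆ Ω →
      ∫ x in Ω, u x * (Δ φ) x = ∫ x in Ω, f x * φ x)
    {τ₁ τ₂ ν : ℝ} (hν : 0 < ν) {r : ℕ → ℝ} (hr : IsQuasiGeometric τ₁ τ₂ r) (hr0 : r 0 = 1)
    (hH : ∀ k, ENNReal.ofReal (ν * r k ^ (n - 1)) ≤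
      μHE[n - 1] (Metric.sphere (0 : 𝔼) (r k) ∩ Ωᶜ))
    {α β : ℝ} (hα : 0 < α) (hβ : 0 < β) (hβ0 : β ≤ holderExponent n τ₁ τ₂ ν)
    (hβp : β ≤ 2 - (n : ℝ) * (p⁻¹).toReal) (hβα : β ≤ α) {c G U : ℝ} (hG0 : 0 ≤ G) (hU0 : 0 ≤ U)
    (hbdry : ∀ z ∈ frontier Ω, |u z - c| ≤ G * ‖z‖ ^ α)
    (hU : ∀ x ∈ Ω ∩ Metric.ball 0 1, |u x - c| ≤ 2 * U) :
    ∀ k, ∀ x ∈ Ω ∩ Metric.ball 0 (r k), |u x - c| ≤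
      (2 * U + 4 * (G + A * lpNormOn p (Ω ∩ Metric.ball 0 1) f) / contractionGain n τ₂ ν)
        * r k ^ β := by
  have hτ₁ := hr.tau_pos
  have hτ₁₂ := hr.tau_lt
  have hτ₂ := hr.tau_lt_one
  have hτ₂0 := hτ₁.trans hτ₁₂
  have hg0 := contractionGain_pos (n := n) hτ₂0 hτ₂ hν
  -- The cap keeps 1 - γ nonnegative and makes the cross term γS/2 at most S/4.
  have hg1 : contractionGain n τ₂ ν ≤ 1 / 2 := min_le_left _ _
  have hgd : contractionGain n τ₂ ν ≤ decayGain n τ₂ ν := min_le_right _ _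
  set γ := contractionGain n τ₂ ν with hγ
  set F := lpNormOn p (Ω ∩ Metric.ball 0 1) f with hF
  have hF0 : 0 ≤ F := lpNormOn_nonneg _ _ _
  set S := G + A * F with hS
  have hS0 : 0 ≤ S := by positivity
  -- The term 2U starts the induction. The other gives γB ≥ 4S: in ((1 - γ)B + S)(1 + γ/2) ≤ B the
  -- saving is at least γB/2 ≥ 2S, which covers S + γS/2.
  set B := 2 * U + 4 * S / γ with hB
  have hB0 : 0 ≤ B := by positivity
  have hBγ : γ * B = 2 * γ * U + 4 * S := by rw [hB]; field_simp
  have hscale : ∀ k, r k ^ β ≤ (1 + γ / 2) * r (k + 1) ^ β := fun k =>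
    hr.rpow_le_mul_rpow_succ hν hβ hβ0 k
  have hr1 : ∀ k, r k ≤ 1 := fun k => (hr.le_pow hr0 k).trans (pow_le_one₀ hτ₂0.le hτ₂.le)
  intro k
  induction k with
  | zero =>
    intro x hx
    rw [hr0] at hx ⊢
    rw [Real.one_rpow, mul_one]
    have : 0 ≤ 4 * S / γ := by positivity
    linarith [hU x hx]
  | succ k ih =>
    intro x hx
    have hrk := hr.pos k
    have hx' : x ∈ Ω ∩ Metric.ball 0 (τ₂ * r k) :=
      ⟨hx.1, Metric.ball_subset_ball (hr.upper k) hx.2⟩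
    have hk0 : 0 ≤ r k ^ β := by positivity
    have h1 := hA Ω u f (r k) τ₂ ν c (G * r k ^ β) (B * r k ^ β) hΩ hrk hτ₂ hν
      (by positivity) (by positivity) (hH k) huc hf heq
      (fun z hz hzr => (hbdry z hz).trans (mul_le_mul_of_nonneg_left
        ((Real.rpow_le_rpow (norm_nonneg z) hzr hα.le).trans
          (Real.rpow_le_rpow_of_exponent_ge hrk (hr1 k) hβα)) hG0))
      ih x hx'
    have h2 : r k ^ (2 - (n : ℝ) * (p⁻¹).toReal) ≤ r k ^ β :=
      Real.rpow_le_rpow_of_exponent_ge hrk (hr1 k) hβp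
    have h3 : lpNormOn p (Ω ∩ Metric.ball 0 (r k)) f ≤ F :=
      lpNormOn_mono (inter_subset_inter_right _ (Metric.ball_subset_ball (hr1 k)))
        (hf.mono_measure (Measure.restrict_mono inter_subset_left le_rfl))
    calc |u x - c| ≤ (1 - γ) * (B * r k ^ β) + G * r k ^ β + A * r k ^ β * F := by
          refine h1.trans (add_le_add (add_le_add ?_ le_rfl) ?_)
          · have : 0 ≤ B * r k ^ β := by positivity
            nlinarith
          · have := lpNormOn_nonneg p (Ω ∩ Metric.ball 0 (r k)) f
            gcongr
      _ = ((1 - γ) * B + S) * r k ^ β := by rw [hS]; ring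
      _ ≤ ((1 - γ) * B + S) * ((1 + γ / 2) * r (k + 1) ^ β) := by
          refine mul_le_mul_of_nonneg_left (hscale k) ?_
          have : 0 ≤ (1 - γ) * B := mul_nonneg (by linarith) hB0
          linarith
      _ = (((1 - γ) * B + S) * (1 + γ / 2)) * r (k + 1) ^ β := by ring
      _ ≤ B * r (k + 1) ^ β := by
          refine mul_le_mul_of_nonneg_right ?_ (Real.rpow_nonneg (hr.pos _).le _)
          have h4 : 0 ≤ γ * U := by positivity
          have h5 : γ * S ≤ 1 / 2 * S := mul_le_mul_of_nonneg_right hg1 hS0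
          have h6 : 0 ≤ γ * (γ * B) := by positivity
          nlinarith

end BoundaryRegularity

theorem theorem3p2 (n : ℕ) (hn : 2 ≤ n) :
    ∃ (β₀ : ℝ → ℝ → ℝ → ℝ) (C : ℝ → ℝ → ℝ≥0∞ → ℝ),
      ∀ τ₁ τ₂ ν : ℝ, 0 < τ₁ → τ₁ < τ₂ → τ₂ < 1 → 0 < ν → ν < 1 →
        0 < β₀ τ₁ τ₂ ν ∧
        ∀ p : ℝ≥0∞, (n : ℝ≥0∞) / 2 < p →
          0 < C τ₂ ν p ∧
          ∀ Ω : Set (EuclideanSpace ℝ (Fin n)), IsBoundedDomain Ω → SatisfiesH1 Ω 0 τ₁ τ₂ ν →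
          ∀ α β : ℝ, 0 < α → 0 < β →
            β ≤ min (β₀ τ₁ τ₂ ν) (min (2 - (n : ℝ) * (p⁻¹).toReal) α) →
          ∀ f g u : EuclideanSpace ℝ (Fin n) → ℝ,
            MemLp f p (volume.restrict Ω) →
            IsHolderAt (frontier Ω) α g 0 →
            IsDirichletSolution Ω f g u →
            IsHolderAt (closure Ω) β u 0 ∧
            ∀ x ∈ Ω ∩ Metric.ball 0 1,
              |u x - u 0| ≤ C τ₂ ν p * ‖x‖ ^ β *
                (lpNormOn ∞ (Ω ∩ Metric.ball 0 1) u + lpNormOn p (Ω ∩ Metric.ball 0 1) f +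
                  holderSeminormAt (frontier Ω) α g 0) := by
  have hA : ∀ p : ℝ≥0∞, ∃ A > 0, (n : ℝ≥0∞) / 2 < p → HasOscillationDecay n p A := by
    intro p
    by_cases hp : (n : ℝ≥0∞) / 2 < p
    · obtain ⟨A, hA, h⟩ := exists_hasOscillationDecay hn hp
      exact ⟨A, hA, fun _ => h⟩
    -- An arbitrary positive value outside the range of p, so that A can be chosen as a function of
    -- p alone.
    · exact ⟨1, one_pos, fun h => absurd h hp⟩
  choose A hA0 hdecay using hA
  -- C comes from 2(2U + 4(G + A F)/γ), with G + A F ≤ (1 + A)(F + G); the outer 2 compares r_k^β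
  -- with ‖x‖^β.
  refine ⟨holderExponent n, fun τ₂ ν p => 4 + 8 * (1 + A p) / contractionGain n τ₂ ν, ?_⟩
  intro τ₁ τ₂ ν hτ₁ hτ₁₂ hτ₂ hν hν1
  refine ⟨holderExponent_pos hτ₁ hτ₁₂ hτ₂ hν, fun p hp => ?_⟩
  have hτ₂0 := hτ₁.trans hτ₁₂
  have hg0 := contractionGain_pos (n := n) hτ₂0 hτ₂ hν
  have hg1 : contractionGain n τ₂ ν ≤ 1 / 2 := min_le_left _ _
  set γ := contractionGain n τ₂ ν with hγ
  have hAp := hA0 p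
  refine ⟨by positivity, ?_⟩
  intro Ω hΩ hH1 α β hα hβ hβle f g u hf hgα hu
  obtain ⟨h0f, -, -, r, hr, hr0, hH⟩ := hH1
  have hβ0 : β ≤ holderExponent n τ₁ τ₂ ν := hβle.trans (min_le_left _ _)
  have hβp : β ≤ 2 - (n : ℝ) * (p⁻¹).toReal :=
    hβle.trans ((min_le_right _ _).trans (min_le_left _ _))
  have hβα : β ≤ α := hβle.trans ((min_le_right _ _).trans (min_le_right _ _))
  set U := lpNormOn ∞ (Ω ∩ Metric.ball 0 1) u with hU
  set F := lpNormOn p (Ω ∩ Metric.ball 0 1) f with hF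
  set G := holderSeminormAt (frontier Ω) α g 0 with hG
  have hF0 : 0 ≤ F := lpNormOn_nonneg _ _ _
  have hG0 : 0 ≤ G := holderSeminormAt_nonneg _ _ _ _
  have hU0 : 0 ≤ U := lpNormOn_nonneg _ _ _
  have hopen : IsOpen (Ω ∩ Metric.ball 0 1) := hΩ.isOpen.inter Metric.isOpen_ball
  obtain ⟨B₀, hB₀⟩ := hΩ.isBounded.isCompact_closure.exists_bound_of_continuousOn hu.continuousOn
  have huU : ∀ x ∈ Ω ∩ Metric.ball 0 1, |u x| ≤ U := fun x hx =>
    abs_le_lpNormOn_top hopen (hu.continuousOn.mono (inter_subset_left.trans subset_closure))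
      (fun y hy => hB₀ y (subset_closure hy.1)) hx
  have h0c : (0 : EuclideanSpace ℝ (Fin n)) ∈ closure Ω := frontier_subset_closure h0f
  have hclos : closure Ω ∩ Metric.ball 0 1 ⊆ closure (Ω ∩ Metric.ball 0 1) :=
    Metric.isOpen_ball.closure_inter
  have hu0 : |u 0| ≤ U :=
    ContinuousWithinAt.closure_le (f := fun x => |u x|) (g := fun _ => U)
      (hclos ⟨h0c, by simp⟩)
      ((hu.continuousOn 0 h0c).abs.mono (inter_subset_left.trans subset_closure))
      continuousWithinAt_const huU
  have hbdry : ∀ z ∈ frontier Ω, |u z - u 0| ≤ G * ‖z‖ ^ α := fun z hz => by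
    have := abs_sub_le_holderSeminormAt hgα hz
    rwa [sub_zero, ← hu.boundary z hz, ← hu.boundary 0 h0f] at this
  set S := G + A p * F with hS
  set B := 2 * U + 4 * S / γ with hB
  have hB0 : 0 ≤ B := by positivity
  have hH' : ∀ k, ENNReal.ofReal (ν * r k ^ (n - 1)) ≤
      μHE[n - 1] (Metric.sphere (0 : EuclideanSpace ℝ (Fin n)) (r k) ∩ Ωᶜ) := fun k => by
    have hrk := hr.pos k
    have h1 := hH k
    rw [ENNReal.le_div_iff_mul_le (Or.inl (by simpa using by positivity))
      (Or.inl ENNReal.ofReal_ne_top)] at h1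
    rwa [ENNReal.ofReal_mul hν.le]
  have hiter : ∀ k, ∀ x ∈ Ω ∩ Metric.ball 0 (r k), |u x - u 0| ≤ B * r k ^ β :=
    (hdecay p hp).abs_sub_le_mul_rpow hAp hΩ.isOpen hu.continuousOn hf hu.equation hν hr hr0 hH' hα hβ
      hβ0 hβp hβα hG0 hU0 hbdry
      (fun x hx => by linarith [abs_sub (u x) (u 0), huU x hx, hu0])
  have hscale : ∀ k, r k ^ β ≤ (1 + γ / 2) * r (k + 1) ^ β := fun k =>
    hr.rpow_le_mul_rpow_succ hν hβ hβ0 k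
  have hmain : ∀ x ∈ Ω ∩ Metric.ball 0 1, |u x - u 0| ≤
      (4 + 8 * (1 + A p) / γ) * ‖x‖ ^ β * (U + F + G) := by
    rintro x ⟨hxΩ, hx1⟩
    have hx0 : x ≠ 0 := by
      rintro rfl
      rw [hΩ.isOpen.frontier_eq] at h0f
      exact h0f.2 hxΩ
    obtain ⟨k, hk1, hk2⟩ := hr.exists_between hr0 (norm_pos_iff.2 hx0) (by simpa using hx1)
    have hxβ : 0 ≤ ‖x‖ ^ β := by positivity
    have h1 : r (k + 1) ^ β ≤ ‖x‖ ^ β := Real.rpow_le_rpow (hr.pos _).le hk1 hβ.le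
    -- Since r_{k+1} ≤ ‖x‖ and 1 + γ/2 ≤ 2.
    have h2 : r k ^ β ≤ 2 * ‖x‖ ^ β :=
      (hscale k).trans (mul_le_mul (by linarith) h1 (Real.rpow_nonneg (hr.pos _).le _) (by norm_num))
    have h3 : 2 * B ≤ (4 + 8 * (1 + A p) / γ) * (U + F + G) := by
      have e : (4 + 8 * (1 + A p) / γ) * (U + F + G) - 2 * B
          = 4 * (F + G) + 8 * ((1 + A p) * U + F + A p * G) / γ := by
        rw [hB, hS]; field_simp; ring
      have : 0 ≤ 4 * (F + G) + 8 * ((1 + A p) * U + F + A p * G) / γ := by positivity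
      linarith
    calc |u x - u 0| ≤ B * r k ^ β := hiter k x ⟨hxΩ, by simpa using hk2⟩
      _ ≤ B * (2 * ‖x‖ ^ β) := by gcongr
      _ = (2 * B) * ‖x‖ ^ β := by ring
      _ ≤ ((4 + 8 * (1 + A p) / γ) * (U + F + G)) * ‖x‖ ^ β := by gcongr
      _ = _ := by ring
  refine ⟨?_, hmain⟩
  set L := (4 + 8 * (1 + A p) / γ) * (U + F + G) with hL
  have hL0 : 0 ≤ L := by positivity
  -- L serves for ‖x‖ < 1, where the estimate extends to the closure by continuity; 2B₀ serves for
  -- ‖x‖ ≥ 1, where ‖x‖^β ≥ 1 and boundedness of u is enough.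
  refine ⟨L + 2 * B₀, fun x hx => ?_⟩
  rw [sub_zero]
  have hB₀0 : 0 ≤ B₀ := (norm_nonneg _).trans (hB₀ x hx)
  have hxβ : 0 ≤ ‖x‖ ^ β := by positivity
  rcases lt_or_ge ‖x‖ 1 with hx1 | hx1
  · have h1 : |u x - u 0| ≤ L * ‖x‖ ^ β := by
      refine ContinuousWithinAt.closure_le (f := fun x => |u x - u 0|) (g := fun x => L * ‖x‖ ^ β)
        (hclos ⟨hx, by simpa using hx1⟩) ?_ ?_ (fun y hy => (hmain y hy).trans_eq (by rw [hL]; ring))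
      · exact ((hu.continuousOn x hx).sub continuousWithinAt_const).abs.mono
          (inter_subset_left.trans subset_closure)
      · exact (continuous_const.mul (continuous_norm.rpow_const fun _ =>
          Or.inr hβ.le)).continuousWithinAt
    nlinarith [mul_nonneg hB₀0 hxβ]
  · have h1 : 1 ≤ ‖x‖ ^ β := Real.one_le_rpow hx1 hβ.le
    have h2 : |u x - u 0| ≤ 2 * B₀ := by
      have h3 := hB₀ x hx
      have h4 := hB₀ 0 h0c
      rw [Real.norm_eq_abs] at h3 h4
      linarith [abs_sub (u x) (u 0)]
    nlinarith
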